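/- Let $0<\alpha<1$, let $a<b$ be real, and let $B$ be a real normalisation function with $B(0)=B(1)=1$ and $B>0$ on $[0,1]$. Write $E_\alpha(x)=\sum_{n\ge 0}\frac{x^n}{\Gamma(\alpha n+1)}$ for the Mittag-Leffler function, and for $F\in L^1(a,b)$ and $a<t<b$ define the ABR fractional derivative by $${}^{ABR}D^{\alpha}_{a+}F(t)=\frac{B(\alpha)}{1-\alpha}\,\frac{\mathrm d}{\mathrm dt}\int_a^t F(x)\,E_\alpha\Big(\tfrac{-\alpha}{1-\alpha}(t-x)^\alpha\Big)\,\mathrm dx .$$ Let $\mathbb K$ be $\mathbb R$ or $\mathbb C$, let $g:(a,b)\to\mathbb K$ be smooth and let $f:\mathbb K\to\mathbb C$ be such that $f\circ g\in L^1(a,b)$. Assume that there are an open set $R\subseteq\mathbb C$ containing $a$, an analytic function $\eta:R\to\mathbb C$ and $\lambda\in\mathbb C$ with $\mathrm{Re}(\lambda)>-1$ such that $f(g(s))=(s-a)^{\lambda}\eta(s)$ for all $s\in(a,b)\cap R$. Let $S$ be the set of all $t\in(a,b)$ such that the closed disc $\{z\in\mathbb C:|z-t|\le t-a\}$ is contained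 in $R$ and $f$ has derivatives of all orders at $g(t)$ (that is, for every $n$, $f$ is $C^n$ over $\mathbb K$ in a neighbourhood of $g(t)$). For $m\ge 0$, $n\ge 1$ and $t\in S$ put $$T_{m,n}(t)=\Big(\tfrac{-\alpha}{1-\alpha}\Big)^m\binom{-m\alpha}{n}\frac{(t-a)^{n+m\alpha}}{\Gamma(n+m\alpha+1)}\sum_{k=1}^n f^{(k)}(g(t))\sum_{(P_1,\dots,P_n)}\ \prod_{i=1}^n\frac{i}{P_i!\,(i!)^{P_i}}\big(g^{(i)}(t)\big)^{P_i},$$ where the last sum is over all $n$-tuples of non-negative integers with $\sum_i P_i=k$ and $\sum_i iP_i=n$. Then: 1. For every $t\in S$ the derivative defining ${}^{ABR}D^{\alpha}_{a+}(f\circ g)(t)$ exists, the double series $\sum_{m\ge0,\,n\ge1}T_{m,n}(t)$ converges absolutely (so the two sums can be interchanged), and $${}^{ABR}D^{\alpha}_{a+}f(g(t))=\frac{B(\alpha)}{1-\alpha}\Big[E_\alpha\Big(\tfrac{-\alpha}{1-\alpha}(t-a)^\alpha\Big)f(g(t))+\sum_{m=0}^\infty\sum_{n=1}^\infty T_{m,n}(t)\Big].$$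 2. The outer series $\sum_{m\ge 0}\big(\sum_{n\ge1}T_{m,n}(t)\big)$ converges locally uniformly in $t\in S$. -/

import Mathlib

open Set
open scoped ContDiff

noncomputable section

/-- The Mittag-Leffler function `E_α(x) = ∑_{n ≥ 0} x ^ n / Γ(α n + 1)`. -/
def mittagLeffler (α x : ℝ) : ℝ :=
  ∑' n : ℕ, x ^ n / Real.Gamma (α * n + 1)

/-- The function `t ↦ ∫_a^t F(x) E_α(-α/(1-α) (t-x)^α) dx`, whose derivative
defines the ABR derivative. -/
def abrIntegral (α a : ℝ) (F : ℝ → ℂ) (t : ℝ) : ℂ :=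
  ∫ x in a..t, F x * (mittagLeffler α (-α / (1 - α) * (t - x) ^ α) : ℂ)

/-- The ABR fractional derivative of order `α` with base point `a` and normalisation
function `B`:
`B(α)/(1-α) * d/dt ∫_a^t F(x) E_α(-α/(1-α) (t-x)^α) dx`. -/
def abrDeriv (B : ℝ → ℝ) (α a : ℝ) (F : ℝ → ℂ) (t : ℝ) : ℂ :=
  ((B α / (1 - α) : ℝ) : ℂ) * deriv (abrIntegral α a F) t

/-- The `n`-tuples `(P_1, …, P_n)` of non-negative integers with `∑ P_i = k` and
`∑ i P_i = n`; the entry `P_i` is stored at the index `i - 1 : Fin n`. -/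
def faaDiBrunoTuples (n k : ℕ) : Finset (Fin n → ℕ) :=
  (Finset.piAntidiag Finset.univ k).filter
    fun P => ∑ i : Fin n, ((i : ℕ) + 1) * P i = n

/-- The Faà di Bruno sum
`∑_{k=1}^n (d^k f / d g^k) ∑_P ∏_{i=1}^n i / (P_i! (i!)^{P_i}) (d^i g / dt^i)^{P_i}`
at `t`. Here the `k`-th derivative of `f` is taken at the point `g t`. -/
def faaDiBrunoSum {𝕜 : Type*} [RCLike 𝕜] [NormedAlgebra 𝕜 ℂ]
    (f : 𝕜 → ℂ) (g : ℝ → 𝕜) (n : ℕ) (t : ℝ) : ℂ :=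
  ∑ k ∈ Finset.Icc 1 n,
    (∑ P ∈ faaDiBrunoTuples n k,
      ∏ i : Fin n,
        (((i : ℕ) + 1 : ℕ) : 𝕜)
            / (((P i).factorial : 𝕜) * ((((i : ℕ) + 1).factorial : ℕ) : 𝕜) ^ P i)
          * (iteratedDeriv ((i : ℕ) + 1) g t) ^ P i)
      • iteratedDeriv k f (g t)

/-- The `(m, n)` term of the double series in the chain rule:
`(-α/(1-α))^m binom(-mα, n) (t-a)^{n+mα} / Γ(n+mα+1)` times the Faà di Bruno sum. -/
def abrChainTerm {𝕜 : Type*} [RCLike 𝕜] [NormedAlgebra 𝕜 ℂ]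
    (α a : ℝ) (f : 𝕜 → ℂ) (g : ℝ → 𝕜) (m n : ℕ) (t : ℝ) : ℂ :=
  (((-α / (1 - α)) ^ m * Ring.choose (-(m : ℝ) * α) n
      * ((t - a) ^ ((n : ℝ) + m * α) / Real.Gamma ((n : ℝ) + m * α + 1)) : ℝ) : ℂ)
    * faaDiBrunoSum f g n t

end

/-!
The ABR integral `∫_a^t F(x) E_α(c (t - x)^α) dx`, with `F = f ∘ g` and `c = -α / (1 - α)`, is
differentiated once and the result is expanded at `t`.

Since `E_α(c u^α) = 1 + ∫_0^u k` for the kernel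
`k(u) = ∑_{m ≥ 1} c^m u^{mα - 1} / Γ(mα)`, Fubini's theorem on a triangle turns the ABR integral
into the primitive of `F + ψ`, where `ψ(τ) = ∫_a^τ F(x) k(τ - x) dx` (`abrIntegral_eq_integral`). For
`t` in `S` one has `F(x) = (x - a)^λ η(x)` on the whole of `(a, t)` and a little beyond, and after
rescaling to `[0, 1]` a beta density dominates the integrand of `ψ`, so `ψ` is continuous at `t`
(`continuousAt_convolution_mlKernel`). Hence the derivative at `t` is `F(t) + ψ(t)`
(`hasDerivAt_abrIntegral`).

To evaluate `ψ(t)`, put `r = t - a` and expand `F(t - r w) = ∑ C_n w^n` for `|w| < 1`. The `C_n`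
are the Cauchy product of the binomial coefficients of `(1 - w)^λ` with the Taylor coefficients of
`η`; the latter decay geometrically because `η` is analytic on a disc slightly larger than
`|z - t| ≤ r`. The hypothesis `Re λ > -1` enters through `∑ |binom λ n| / (n + 1) < ∞`
(`summable_norm_choose_div`), which gives `∑ |C_n| / (n + 1) < ∞`, locally uniformly in `t`
(`exists_eventually_diskCoeff_bound`). Integrating the product of this expansion with the series
of `k` term by term yields `ψ(t)` as an absolutely convergent double series with terms
`c^m r^{mα} C_n / (Γ(mα) (n + mα))` (`hasSum_convolution_mlKernel`). The terms with `n = 0` add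
up to `(E_α(c r^α) - 1) F(t)`. The terms with `n ≥ 1` are those of the chain rule: `C_n` is
`(-r)^n F^{(n)}(t) / n!`, the Faà di Bruno sum is `F^{(n)}(t)` (`faaDiBrunoSum_eq_iteratedDeriv`),
and the identity between `binom(-mα, n)` and quotients of Gamma values is `choose_neg_mul_Gamma`.

The weights are bounded by a summable sequence in `m` times `1 / (n + 1)` (`abs_chainWeight_le`);
this gives the absolute convergence, and the locally uniform convergence by the Weierstrass test.
-/

open MeasureTheory Filter Topology

/-! ### Mittag-Leffler functions and the kernel -/

/-- The two-parameter Mittag-Leffler function `E_{α,β}(x) = ∑_{n ≥ 0} x ^ n / Γ(α n + β)`. -/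
noncomputable def mittagLefflerTwo (α β x : ℝ) : ℝ :=
  ∑' n : ℕ, x ^ n / Real.Gamma (α * n + β)

/-- The derivative of `v ↦ E_α(c v ^ α)` for `v > 0`; it is integrable at `0` although it is
unbounded there. -/
noncomputable def mlKernel (α c v : ℝ) : ℝ :=
  c * v ^ (α - 1) * mittagLefflerTwo α α (c * v ^ α)

/-- Log-convexity of `Γ` bounds the growth of the quotient `Γ(y) / Γ(y + α)`. -/
theorem Gamma_div_Gamma_add_le {α y : ℝ} (hα0 : 0 < α) (hα1 : α < 1) (hy : 0 < y) :
    Real.Gamma y / Real.Gamma (y + α) ≤ (y + α) ^ (1 - α) / y := by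
  have h := Real.Gamma_mul_add_mul_le_rpow_Gamma_mul_rpow_Gamma (s := y + α) (t := y + α + 1)
    (a := α) (b := 1 - α) (by positivity) (by positivity) hα0 (by linarith) (by ring)
  rw [show α * (y + α) + (1 - α) * (y + α + 1) = y + 1 by ring, Real.Gamma_add_one hy.ne',
    Real.Gamma_add_one (by positivity)] at h
  have hG : 0 < Real.Gamma (y + α) := Real.Gamma_pos_of_pos (by positivity)
  rw [Real.mul_rpow (by positivity) hG.le] at h
  rw [div_le_div_iff₀ hG hy]
  calc Real.Gamma y * y = y * Real.Gamma y := mul_comm _ _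
    _ ≤ _ := h
    _ = (y + α) ^ (1 - α) * (Real.Gamma (y + α) ^ α * Real.Gamma (y + α) ^ (1 - α)) := by ring
    _ = _ := by rw [← Real.rpow_add hG]; simp

theorem tendsto_Gamma_div_Gamma_add {α : ℝ} (hα0 : 0 < α) (hα1 : α < 1) :
    Tendsto (fun y : ℝ => Real.Gamma y / Real.Gamma (y + α)) atTop (𝓝 0) := by
  have h1 : Tendsto (fun y : ℝ => (y + α) ^ (-α) * (1 + α * y⁻¹)) atTop (𝓝 (0 * (1 + α * 0))) :=
    ((tendsto_rpow_neg_atTop hα0).comp (tendsto_atTop_add_const_right _ _ tendsto_id)).mul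
      (tendsto_const_nhds.add (tendsto_const_nhds.mul tendsto_inv_atTop_zero))
  rw [zero_mul] at h1
  refine tendsto_of_tendsto_of_tendsto_of_le_of_le' tendsto_const_nhds h1 ?_ ?_
  · filter_upwards [eventually_gt_atTop 0] with y hy
    have := Real.Gamma_pos_of_pos hy
    have := Real.Gamma_pos_of_pos (show 0 < y + α by positivity)
    positivity
  · filter_upwards [eventually_gt_atTop 0] with y hy
    refine (Gamma_div_Gamma_add_le hα0 hα1 hy).trans (le_of_eq ?_)
    rw [show 1 - α = -α + 1 by ring, Real.rpow_add_one (by positivity)]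
    field_simp

theorem summable_pow_div_Gamma {α β : ℝ} (hα0 : 0 < α) (hα1 : α < 1) (hβ : 0 < β) (x : ℝ) :
    Summable (fun n : ℕ => x ^ n / Real.Gamma (α * n + β)) := by
  rcases eq_or_ne x 0 with rfl | hx
  · exact summable_of_ne_finset_zero (s := {0}) (fun n hn => by
      rw [zero_pow (by simpa using hn), zero_div])
  have hpos : ∀ n : ℕ, 0 < Real.Gamma (α * n + β) := fun n =>
    Real.Gamma_pos_of_pos (by positivity)
  refine summable_of_ratio_test_tendsto_lt_one (l := 0) one_pos
    (Eventually.of_forall fun n => div_ne_zero (pow_ne_zero _ hx) (hpos n).ne') ?_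
  have h1 : Tendsto (fun n : ℕ => α * n + β) atTop atTop :=
    tendsto_atTop_add_const_right _ _ (tendsto_natCast_atTop_atTop.const_mul_atTop hα0)
  have h2 := ((tendsto_Gamma_div_Gamma_add hα0 hα1).comp h1).const_mul |x|
  rw [mul_zero] at h2
  refine h2.congr fun n => ?_
  have e : α * ((n + 1 : ℕ) : ℝ) + β = α * n + β + α := by push_cast; ring
  have hp' := hpos (n + 1)
  rw [e] at hp'
  simp only [Function.comp, e, norm_div, norm_pow, Real.norm_eq_abs, abs_of_pos (hpos n),
    abs_of_pos hp']
  have := (hpos n).ne'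
  have := hp'.ne'
  have : |x| ≠ 0 := abs_ne_zero.2 hx
  field_simp
  ring

theorem continuous_mittagLefflerTwo {α β : ℝ} (hα0 : 0 < α) (hα1 : α < 1) (hβ : 0 < β) :
    Continuous (mittagLefflerTwo α β) := by
  refine continuous_iff_continuousAt.2 fun x => ?_
  have : ContinuousOn (mittagLefflerTwo α β) (Metric.ball 0 (|x| + 1)) := by
    refine continuousOn_tsum (fun n => by fun_prop)
      (summable_pow_div_Gamma hα0 hα1 hβ (|x| + 1)) fun n y hy => ?_
    have hp : 0 < Real.Gamma (α * n + β) := Real.Gamma_pos_of_pos (by positivity)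
    rw [norm_div, norm_pow, Real.norm_eq_abs (Real.Gamma _), abs_of_pos hp]
    have : ‖y‖ ≤ |x| + 1 := by simpa using (mem_ball_zero_iff.1 hy).le
    gcongr
  exact this.continuousAt (Metric.isOpen_ball.mem_nhds (by simp))

theorem continuousOn_mlKernel {α : ℝ} (hα0 : 0 < α) (hα1 : α < 1) (c : ℝ) :
    ContinuousOn (mlKernel α c) (Ioi 0) := by
  have h1 : ContinuousOn (fun v : ℝ => v ^ (α - 1)) (Ioi 0) := fun v hv =>
    (Real.continuousAt_rpow_const _ _ (Or.inl (ne_of_gt hv))).continuousWithinAt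
  have h2 : Continuous (fun v : ℝ => mittagLefflerTwo α α (c * v ^ α)) :=
    (continuous_mittagLefflerTwo hα0 hα1 hα0).comp
      (continuous_const.mul (Real.continuous_rpow_const hα0.le))
  exact (continuousOn_const.mul h1).mul h2.continuousOn

theorem intervalIntegrable_mlKernel {α : ℝ} (hα0 : 0 < α) (hα1 : α < 1) (c u : ℝ) :
    IntervalIntegrable (mlKernel α c) volume 0 u := by
  have h2 : Continuous (fun v : ℝ => mittagLefflerTwo α α (c * v ^ α)) :=
    (continuous_mittagLefflerTwo hα0 hα1 hα0).comp
      (continuous_const.mul (Real.continuous_rpow_const hα0.le))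
  exact ((intervalIntegral.intervalIntegrable_rpow' (by linarith)).const_mul c).mul_continuousOn
    h2.continuousOn

/-- Pointwise series for the kernel: `∑ c ^ (m + 1) v ^ ((m + 1) α - 1) / Γ((m + 1) α)`. -/
theorem hasSum_mlKernel {α : ℝ} (hα0 : 0 < α) (hα1 : α < 1) (c : ℝ) {v : ℝ} (hv : 0 < v) :
    HasSum (fun m : ℕ => c ^ (m + 1) / Real.Gamma ((m + 1) * α) * v ^ ((m + 1) * α - 1))
      (mlKernel α c v) := by
  have h := (summable_pow_div_Gamma hα0 hα1 hα0 (c * v ^ α)).hasSum.mul_left (c * v ^ (α - 1))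
  suffices e : (fun m : ℕ => c ^ (m + 1) / Real.Gamma ((m + 1) * α) * v ^ ((m + 1) * α - 1))
      = fun m : ℕ => c * v ^ (α - 1) * ((c * v ^ α) ^ m / Real.Gamma (α * m + α)) by
    rw [e]
    exact h
  ext m
  rw [show ((m : ℝ) + 1) * α - 1 = α - 1 + α * m by ring, Real.rpow_add hv,
    Real.rpow_mul hv.le, Real.rpow_natCast, mul_pow, show ((m : ℝ) + 1) * α = α * m + α by ring]
  ring

theorem summable_pow_div_Gamma_succ_mul {α : ℝ} (hα0 : 0 < α) (hα1 : α < 1) (x : ℝ) :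
    Summable (fun m : ℕ => x ^ (m + 1) / Real.Gamma ((m + 1) * α)) := by
  refine ((summable_pow_div_Gamma hα0 hα1 hα0 x).mul_left x).congr fun m => ?_
  rw [show ((m : ℝ) + 1) * α = α * m + α by ring]
  ring

/-- `E_α(c u ^ α)` is the primitive of the kernel that equals `1` at `0`. -/
theorem mittagLeffler_eq_one_add_integral {α : ℝ} (hα0 : 0 < α) (hα1 : α < 1) (c : ℝ) {u : ℝ}
    (hu : 0 ≤ u) :
    mittagLeffler α (c * u ^ α) = 1 + ∫ v in (0 : ℝ)..u, mlKernel α c v := by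
  have hΓ : ∀ m : ℕ, 0 < Real.Gamma ((m + 1) * α) := fun m => Real.Gamma_pos_of_pos (by positivity)
  have hint : ∀ m : ℕ, ∫ v in (0 : ℝ)..u, v ^ (((m : ℝ) + 1) * α - 1)
      = u ^ (((m : ℝ) + 1) * α) / ((m + 1) * α) := fun m => by
    have : 0 < ((m : ℝ) + 1) * α := by positivity
    rw [integral_rpow (Or.inl (by linarith)), sub_add_cancel, Real.zero_rpow this.ne', sub_zero]
  have hpow : ∀ m : ℕ, u ^ (((m : ℝ) + 1) * α) = (u ^ α) ^ (m + 1) := fun m => by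
    rw [mul_comm, Real.rpow_mul hu, ← Real.rpow_natCast]; push_cast; rfl
  have hterm : ∀ m : ℕ, Real.Gamma (α * ((m + 1 : ℕ) : ℝ) + 1)
      = ((m + 1) * α) * Real.Gamma ((m + 1) * α) := fun m => by
    rw [← Real.Gamma_add_one (by positivity)]; push_cast; ring_nf
  have hs1 := summable_pow_div_Gamma hα0 hα1 one_pos (c * u ^ α)
  have hs2 := summable_pow_div_Gamma hα0 hα1 one_pos (|c| * u ^ α)
  have key := hasSum_integral_of_summable_integral_norm (μ := volume.restrict (Ioc 0 u))
    (F := fun (m : ℕ) (v : ℝ) =>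
      c ^ (m + 1) / Real.Gamma ((m + 1) * α) * v ^ (((m : ℝ) + 1) * α - 1)) ?_ ?_
  · have e : ∫ v in Ioc 0 u, (∑' m : ℕ, c ^ (m + 1) / Real.Gamma ((m + 1) * α)
        * v ^ (((m : ℝ) + 1) * α - 1)) = ∫ v in (0 : ℝ)..u, mlKernel α c v := by
      rw [intervalIntegral.integral_of_le hu]
      exact setIntegral_congr_fun measurableSet_Ioc fun v hv =>
        (hasSum_mlKernel hα0 hα1 c hv.1).tsum_eq
    rw [e] at key
    rw [mittagLeffler, hs1.tsum_eq_zero_add, ← key.tsum_eq]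
    congr 1
    · simp
    · refine tsum_congr fun m => ?_
      rw [integral_const_mul, ← intervalIntegral.integral_of_le hu, hint, hterm, mul_pow, hpow]
      field_simp
  · intro m
    have : 0 < ((m : ℝ) + 1) * α := by positivity
    exact ((intervalIntegrable_iff_integrableOn_Ioc_of_le hu).1
      (intervalIntegral.intervalIntegrable_rpow' (by linarith))).const_mul _
  · refine ((summable_nat_add_iff 1).2 hs2).congr fun m => ?_
    have : ∫ v in Ioc 0 u, ‖c ^ (m + 1) / Real.Gamma ((m + 1) * α)
        * v ^ (((m : ℝ) + 1) * α - 1)‖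
        = ∫ v in Ioc 0 u, |c| ^ (m + 1) / Real.Gamma ((m + 1) * α)
          * v ^ (((m : ℝ) + 1) * α - 1) := by
      refine setIntegral_congr_fun measurableSet_Ioc fun v hv => ?_
      simp only [norm_mul, norm_div, norm_pow, Real.norm_eq_abs, abs_of_pos (hΓ m),
        abs_of_pos (Real.rpow_pos_of_pos hv.1 _)]
    rw [this, integral_const_mul, ← intervalIntegral.integral_of_le hu, hint, hterm, mul_pow, hpow]
    field_simp

/-! ### The ABR integral as a primitive -/

/-- Fubini's theorem on the triangle `a < x < τ ≤ s`: integrating a kernel `k` before convolving is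
the same as convolving and then integrating. -/
theorem integral_mul_integral_eq_integral_convolution {h k : ℝ → ℂ} {a s : ℝ} (has : a ≤ s)
    (hh : IntegrableOn h (Ioc a s)) (hk : IntegrableOn k (Ioc 0 (s - a))) :
    IntervalIntegrable (fun τ => ∫ x in a..τ, h x * k (τ - x)) volume a s ∧
    ∫ x in a..s, h x * ∫ v in (0 : ℝ)..(s - x), k v
      = ∫ τ in a..s, ∫ x in a..τ, h x * k (τ - x) := by
  -- extending both factors by zero makes the product integrable on the strip `(a, s] × ℝ`
  set h' := (Ioc a s).indicator h with hh'
  set k' := (Ioc 0 (s - a)).indicator k with hk'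
  have ih : Integrable h' := (integrable_indicator_iff measurableSet_Ioc).2 hh
  have ik : Integrable k' := (integrable_indicator_iff measurableSet_Ioc).2 hk
  have iF : Integrable (fun p : ℝ × ℝ => h' p.2 * k' (p.1 - p.2))
      ((volume.restrict (Ioc a s)).prod volume) := by
    have := ih.convolution_integrand (ContinuousLinearMap.mul ℝ ℂ) ik
    simp only [ContinuousLinearMap.mul_apply'] at this
    have h2 := this.integrableOn (s := Ioc a s ×ˢ univ)
    rwa [IntegrableOn, ← Measure.prod_restrict, Measure.restrict_univ] at h2
  have inner1 : ∀ τ ∈ Ioc a s, ∫ x, h' x * k' (τ - x) = ∫ x in a..τ, h x * k (τ - x) := by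
    intro τ hτ
    rw [intervalIntegral.integral_of_le hτ.1.le, integral_Ioc_eq_integral_Ioo,
      ← integral_indicator measurableSet_Ioo]
    congr 1
    ext x
    by_cases hx : x ∈ Ioo a τ
    · rw [indicator_of_mem hx, hh', hk', indicator_of_mem, indicator_of_mem]
      · exact ⟨by linarith [hx.2], by linarith [hx.1, hτ.2]⟩
      · exact ⟨hx.1, hx.2.le.trans hτ.2⟩
    · rw [indicator_of_notMem hx]
      by_cases hx1 : x ∈ Ioc a s
      · rw [hk', indicator_of_notMem, mul_zero]
        intro h0
        exact hx ⟨hx1.1, by linarith [h0.1]⟩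
      · rw [hh', indicator_of_notMem hx1, zero_mul]
  have inner2 : ∀ x ∈ Ioc a s, ∫ τ in Ioc a s, h' x * k' (τ - x)
      = h x * ∫ v in (0 : ℝ)..(s - x), k v := by
    intro x hx
    rw [integral_const_mul, hh', indicator_of_mem hx, ← intervalIntegral.integral_of_le has,
      intervalIntegral.integral_comp_sub_right k' x,
      intervalIntegral.integral_of_le (by linarith),
      intervalIntegral.integral_of_le (by linarith [hx.2]), hk',
      ← integral_indicator measurableSet_Ioc, ← integral_indicator measurableSet_Ioc,
      indicator_indicator]
    have e : Ioc (a - x) (s - x) ∩ Ioc 0 (s - a) = Ioc 0 (s - x) := ?_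
    · rw [e]
    ext v
    simp only [mem_inter_iff, mem_Ioc]
    constructor
    · rintro ⟨⟨_, h1⟩, h2, _⟩
      exact ⟨h2, h1⟩
    · rintro ⟨h1, h2⟩
      exact ⟨⟨by linarith [hx.1], h2⟩, h1, by linarith [hx.1]⟩
  constructor
  · rw [intervalIntegrable_iff_integrableOn_Ioc_of_le has]
    exact (integrableOn_congr_fun inner1 measurableSet_Ioc).1 iF.integral_prod_left
  · rw [intervalIntegral.integral_of_le has, intervalIntegral.integral_of_le has,
      ← setIntegral_congr_fun measurableSet_Ioc inner1, integral_integral_swap iF,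
      ← setIntegral_congr_fun measurableSet_Ioc inner2, ← integral_indicator measurableSet_Ioc]
    congr 1
    ext x
    by_cases hx : x ∈ Ioc a s
    · rw [indicator_of_mem hx]
    · rw [indicator_of_notMem hx]
      simp [hh', indicator_of_notMem hx]

/-- The ABR integral as the primitive of `F` plus the convolution of `F` with the kernel. -/
theorem abrIntegral_eq_integral {F : ℝ → ℂ} {α a s : ℝ} (hα0 : 0 < α) (hα1 : α < 1) (has : a ≤ s)
    (hF : IntegrableOn F (Ioc a s)) :
    IntervalIntegrable
      (fun τ => ∫ x in a..τ, F x * (mlKernel α (-α / (1 - α)) (τ - x) : ℂ)) volume a s ∧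
    abrIntegral α a F s
      = ∫ τ in a..s, (F τ + ∫ x in a..τ, F x * (mlKernel α (-α / (1 - α)) (τ - x) : ℂ)) := by
  set c := -α / (1 - α)
  have hk : IntegrableOn (fun v => (mlKernel α c v : ℂ)) (Ioc 0 (s - a)) :=
    ((intervalIntegrable_iff_integrableOn_Ioc_of_le (by linarith)).1
      (intervalIntegrable_mlKernel hα0 hα1 c (s - a))).ofReal
  obtain ⟨h1, h2⟩ := integral_mul_integral_eq_integral_convolution has hF hk
  refine ⟨h1, ?_⟩
  have hF' := (intervalIntegrable_iff_integrableOn_Ioc_of_le has).2 hF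
  have hcont : ContinuousOn (fun x => ∫ v in (0 : ℝ)..(s - x), (mlKernel α c v : ℂ))
      (uIcc a s) := by
    have : ContinuousOn (fun y => ∫ v in (0 : ℝ)..y, (mlKernel α c v : ℂ)) (uIcc 0 (s - a)) :=
      intervalIntegral.continuousOn_primitive_interval
        (by rw [uIcc_of_le (by linarith), integrableOn_Icc_iff_integrableOn_Ioc]; exact hk)
    refine this.comp (by fun_prop) fun x hx => ?_
    rw [uIcc_of_le has] at hx
    rw [uIcc_of_le (by linarith)]
    exact ⟨by linarith [hx.2], by linarith [hx.1]⟩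
  rw [intervalIntegral.integral_add hF' h1, ← h2, abrIntegral,
    ← intervalIntegral.integral_add hF' (hF'.mul_continuousOn hcont)]
  refine intervalIntegral.integral_congr fun x hx => ?_
  rw [uIcc_of_le has] at hx
  rw [mittagLeffler_eq_one_add_integral hα0 hα1 c (by linarith [hx.2]),
    intervalIntegral.integral_ofReal]
  push_cast
  ring

/-! ### Continuity of the convolution with the kernel -/

theorem intervalIntegrable_rpow_mul_one_sub_rpow {x y : ℝ} (hx : -1 < x) (hy : -1 < y) :
    IntervalIntegrable (fun v : ℝ => v ^ x * (1 - v) ^ y) volume 0 1 := by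
  have h := (Complex.betaIntegral_convergent (u := (x + 1 : ℝ)) (v := (y + 1 : ℝ))
    (by rw [Complex.ofReal_re]; linarith) (by rw [Complex.ofReal_re]; linarith)).norm
  refine h.congr fun v hv => ?_
  rw [uIoc_of_le zero_le_one] at hv
  have h1 : 0 ≤ 1 - v := by linarith [hv.2]
  have e : (v : ℂ) ^ (((x + 1 : ℝ) : ℂ) - 1) * (1 - (v : ℂ)) ^ (((y + 1 : ℝ) : ℂ) - 1)
      = ((v ^ x * (1 - v) ^ y : ℝ) : ℂ) := by
    push_cast
    rw [Complex.ofReal_cpow hv.1.le, Complex.ofReal_cpow h1]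
    push_cast
    simp
  rw [e, Complex.norm_real, Real.norm_of_nonneg]
  exact mul_nonneg (Real.rpow_nonneg hv.1.le _) (Real.rpow_nonneg h1 _)

theorem measurable_mlKernel {α : ℝ} (hα0 : 0 < α) (hα1 : α < 1) (c : ℝ) :
    Measurable (mlKernel α c) := by
  have := (continuous_mittagLefflerTwo hα0 hα1 hα0).measurable
  unfold mlKernel
  fun_prop

theorem exists_Icc_ofReal_mem {R : Set ℂ} (hR : IsOpen R) {a t : ℝ} (hat : a ≤ t)
    (hseg : ∀ x ∈ Icc a t, (x : ℂ) ∈ R) : ∃ t₂ > t, ∀ x ∈ Icc a t₂, (x : ℂ) ∈ R := by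
  have hO : IsOpen {x : ℝ | (x : ℂ) ∈ R} := hR.preimage Complex.continuous_ofReal
  obtain ⟨ε, hε, hb⟩ := Metric.isOpen_iff.1 hO t (hseg t ⟨hat, le_rfl⟩)
  refine ⟨t + ε / 2, by linarith, fun x hx => ?_⟩
  rcases le_total x t with h | h
  · exact hseg x ⟨hx.1, h⟩
  · refine hb ?_
    rw [Metric.mem_ball, Real.dist_eq, abs_of_nonneg (by linarith)]
    linarith [hx.2]

/-- The convolution of the kernel with `(x - a) ^ λ η(x)` is continuous: after rescaling the
interval of integration to `[0, 1]`, the integrand is dominated by a beta density. -/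
theorem continuousAt_convolution_mlKernel {α : ℝ} (hα0 : 0 < α) (hα1 : α < 1) (c : ℝ) {a t : ℝ}
    (hat : a < t) {lam : ℂ} (hlam : -1 < lam.re) {η : ℂ → ℂ} {R : Set ℂ} (hR : IsOpen R)
    (hη : ContinuousOn η R) (hseg : ∀ x ∈ Icc a t, (x : ℂ) ∈ R) {F : ℝ → ℂ}
    (hF : ∀ᶠ s in 𝓝 t, ∀ x ∈ Ioo a s, F x = ((x - a : ℝ) : ℂ) ^ lam * η x) :
    ContinuousAt (fun s => ∫ x in a..s, F x * (mlKernel α c (s - x) : ℂ)) t := by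
  obtain ⟨t₂, ht₂, hseg₂⟩ := exists_Icc_ofReal_mem hR hat.le hseg
  -- keeping `s - a` away from `0` bounds the negative powers of `s - a`
  set t₁ := (a + t) / 2 with ht₁
  have hat₁ : a < t₁ := by linarith
  have ht₁t : t₁ < t := by linarith
  have hnear : ∀ᶠ s in 𝓝 t, s ∈ Icc t₁ t₂ := Icc_mem_nhds ht₁t ht₂
  set G : ℝ → ℝ → ℂ := fun s v => ((s - a : ℝ) : ℂ) * ((((s - a) * v : ℝ) : ℂ) ^ lam
    * η ((a + (s - a) * v : ℝ)) * (mlKernel α c ((s - a) * (1 - v)) : ℂ)) with hG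
  have hmem : ∀ s ∈ Icc t₁ t₂, ∀ v ∈ Icc (0 : ℝ) 1, a + (s - a) * v ∈ Icc a t₂ := by
    intro s hs v hv
    have h1 : 0 < s - a := by linarith [hs.1]
    constructor
    · nlinarith [hv.1]
    · nlinarith [hv.2, hs.2]
  have heq : ∀ᶠ s in 𝓝 t, ∫ x in a..s, F x * (mlKernel α c (s - x) : ℂ)
      = ∫ v in (0 : ℝ)..1, G s v := by
    filter_upwards [hF, hnear] with s hs hs'
    have h1 : 0 < s - a := by linarith [hs'.1]
    have e1 : ∫ x in a..s, F x * (mlKernel α c (s - x) : ℂ)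
        = ∫ x in a..s, ((x - a : ℝ) : ℂ) ^ lam * η x * (mlKernel α c (s - x) : ℂ) := by
      rw [intervalIntegral.integral_of_le (by linarith), intervalIntegral.integral_of_le
        (by linarith), integral_Ioc_eq_integral_Ioo, integral_Ioc_eq_integral_Ioo]
      refine setIntegral_congr_fun measurableSet_Ioo fun x hx => ?_
      simp only [hs x hx]
    have e2 := intervalIntegral.smul_integral_comp_add_mul (a := 0) (b := 1)
      (fun x : ℝ => ((x - a : ℝ) : ℂ) ^ lam * η x * (mlKernel α c (s - x) : ℂ)) (s - a) a
    rw [mul_zero, mul_one, add_zero, add_sub_cancel] at e2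
    rw [e1, ← e2, ← intervalIntegral.integral_smul]
    refine intervalIntegral.integral_congr fun v _ => ?_
    simp only [hG, Complex.real_smul]
    rw [show a + (s - a) * v - a = (s - a) * v by ring,
      show s - (a + (s - a) * v) = (s - a) * (1 - v) by ring]
  -- uniform bounds for the three continuous factors
  obtain ⟨Mη, hMη⟩ := (isCompact_Icc (a := a) (b := t₂)).exists_bound_of_continuousOn
    (f := fun x : ℝ => η x) (hη.comp Complex.continuous_ofReal.continuousOn hseg₂)
  obtain ⟨ME, hME⟩ := (isCompact_Icc (a := (0 : ℝ)) (b := t₂ - a)).exists_bound_of_continuousOn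
    (f := fun y : ℝ => c * mittagLefflerTwo α α (c * y ^ α))
    (continuous_const.mul ((continuous_mittagLefflerTwo hα0 hα1 hα0).comp
      (continuous_const.mul (Real.continuous_rpow_const hα0.le)))).continuousOn
  obtain ⟨Mr, hMr⟩ := (isCompact_Icc (a := t₁) (b := t₂)).exists_bound_of_continuousOn
    (f := fun s : ℝ => (s - a) * ((s - a) ^ lam.re * (s - a) ^ (α - 1))) (fun s hs => by
      have h1 : s - a ≠ 0 := by linarith [hs.1]
      have h2 : ContinuousAt (fun s : ℝ => s - a) s := by fun_prop
      exact (h2.mul ((h2.rpow_const (Or.inl h1)).mul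
        (h2.rpow_const (Or.inl h1)))).continuousWithinAt)
  refine ContinuousAt.congr ?_ (heq.mono fun s hs => hs.symm)
  refine intervalIntegral.continuousAt_of_dominated_interval
    (bound := fun v => Mr * Mη * ME * (v ^ lam.re * (1 - v) ^ (α - 1))) ?_ ?_ ?_ ?_
  · filter_upwards [hnear] with s hs
    have h1 : 0 < s - a := by linarith [hs.1]
    rw [uIoc_of_le zero_le_one]
    have m1 : ContinuousOn (fun v : ℝ => (((s - a) * v : ℝ) : ℂ) ^ lam) (Ioc 0 1) := by
      refine ContinuousOn.cpow_const (by fun_prop) fun v hv => ?_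
      rw [Complex.ofReal_mem_slitPlane]
      exact mul_pos h1 hv.1
    have m2 : ContinuousOn (fun v : ℝ => η ((a + (s - a) * v : ℝ))) (Ioc 0 1) :=
      hη.comp (by fun_prop) fun v hv => hseg₂ _ (hmem s hs v ⟨hv.1.le, hv.2⟩)
    have m3 : Measurable (fun v : ℝ => (mlKernel α c ((s - a) * (1 - v)) : ℂ)) := by
      have := measurable_mlKernel hα0 hα1 c
      fun_prop
    exact (((m1.mul m2).aestronglyMeasurable measurableSet_Ioc).mul
      m3.aestronglyMeasurable).const_mul _
  · filter_upwards [hnear] with s hs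
    refine Eventually.of_forall fun v hv => ?_
    rw [uIoc_of_le zero_le_one] at hv
    have h1 : 0 < s - a := by linarith [hs.1]
    have h2 : 0 ≤ 1 - v := by linarith [hv.2]
    have b1 := hMr s hs
    have b2 := hMη _ (hmem s hs v ⟨hv.1.le, hv.2⟩)
    have b3 := hME ((s - a) * (1 - v)) ⟨by positivity, by nlinarith [hv.1, hs.2]⟩
    rw [Real.norm_of_nonneg (by positivity)] at b1
    simp only [hG, norm_mul, Complex.norm_real, Real.norm_of_nonneg h1.le]
    rw [Complex.norm_cpow_eq_rpow_re_of_pos (mul_pos h1 hv.1), Real.mul_rpow h1.le hv.1.le]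
    have e : ‖mlKernel α c ((s - a) * (1 - v))‖ = (s - a) ^ (α - 1) * (1 - v) ^ (α - 1)
        * ‖c * mittagLefflerTwo α α (c * ((s - a) * (1 - v)) ^ α)‖ := by
      rw [mlKernel, norm_mul, norm_mul, norm_mul, Real.norm_of_nonneg
        (Real.rpow_nonneg (by positivity) _), Real.mul_rpow h1.le h2]
      ring
    rw [e]
    calc _ = ((s - a) * ((s - a) ^ lam.re * (s - a) ^ (α - 1)))
          * ‖η ((a + (s - a) * v : ℝ))‖
          * ‖c * mittagLefflerTwo α α (c * ((s - a) * (1 - v)) ^ α)‖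
          * (v ^ lam.re * (1 - v) ^ (α - 1)) := by ring
      _ ≤ _ := by
        have p0 : 0 ≤ v := hv.1.le
        have p1 : 0 ≤ Mη := (norm_nonneg _).trans b2
        have p2 : 0 ≤ Mr := le_trans (by positivity) b1
        gcongr
  · exact (intervalIntegrable_rpow_mul_one_sub_rpow hlam (by linarith)).const_mul _
  · have hne : ∀ᵐ v : ℝ, v ≠ 1 := Measure.ae_ne volume 1
    filter_upwards [hne] with v hv1 hv
    rw [uIoc_of_le zero_le_one] at hv
    have h1 : 0 < t - a := by linarith
    have hv' : 0 < 1 - v := by have := lt_of_le_of_ne hv.2 hv1; linarith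
    have c0 : ContinuousAt (fun s : ℝ => ((s - a : ℝ) : ℂ)) t := by fun_prop
    have c1 : ContinuousAt (fun s : ℝ => (((s - a) * v : ℝ) : ℂ) ^ lam) t := by
      refine ContinuousAt.cpow (by fun_prop) continuousAt_const ?_
      rw [Complex.ofReal_mem_slitPlane]
      exact mul_pos h1 hv.1
    have c2 : ContinuousAt (fun s : ℝ => η ((a + (s - a) * v : ℝ))) t :=
      ContinuousAt.comp (f := fun s : ℝ => ((a + (s - a) * v : ℝ) : ℂ)) (g := η)
        (hη.continuousAt (hR.mem_nhds
          (hseg₂ _ (hmem t ⟨ht₁t.le, ht₂.le⟩ v ⟨hv.1.le, hv.2⟩)))) (by fun_prop)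
    have c3 : ContinuousAt (fun s : ℝ => (mlKernel α c ((s - a) * (1 - v)) : ℂ)) t :=
      Complex.continuous_ofReal.continuousAt.comp
        (ContinuousAt.comp (f := fun s : ℝ => (s - a) * (1 - v)) (g := mlKernel α c)
          ((continuousOn_mlKernel hα0 hα1 c).continuousAt (Ioi_mem_nhds (mul_pos h1 hv')))
          (by fun_prop))
    exact c0.mul ((c1.mul c2).mul c3)

/-! ### Faà di Bruno's formula -/

/-- The coefficients of a convergent expansion in powers of `z - z₀` are the Taylor coefficients. -/
theorem iteratedDeriv_eq_factorial_smul_of_hasSum {𝕜 E : Type*} [NontriviallyNormedField 𝕜]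
    [NormedAddCommGroup E] [NormedSpace 𝕜 E] [CompleteSpace E] {f : 𝕜 → E} {c : ℕ → E} {z₀ : 𝕜}
    (h : ∀ᶠ z in 𝓝 z₀, HasSum (fun n => (z - z₀) ^ n • c n) (f z)) (n : ℕ) :
    iteratedDeriv n f z₀ = n.factorial • c n := by
  set p : FormalMultilinearSeries 𝕜 𝕜 E :=
    fun n => ContinuousMultilinearMap.mkPiRing 𝕜 (Fin n) (c n) with hp
  have hcoeff : ∀ n, p.coeff n = c n := fun n => by
    simp [hp, FormalMultilinearSeries.coeff]
  have hps : HasFPowerSeriesAt f p z₀ := by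
    rw [hasFPowerSeriesAt_iff']
    simpa only [hcoeff] using h
  obtain ⟨r, hr⟩ := hps
  rw [iteratedDeriv_eq_iteratedFDeriv, ← hr.factorial_smul, ← hcoeff]
  rfl

theorem iteratedDeriv_sum_range_pow_smul {𝕜 E : Type*} [NontriviallyNormedField 𝕜]
    [NormedAddCommGroup E] [NormedSpace 𝕜 E] [CompleteSpace E] (c : ℕ → E) (z₀ : 𝕜) {k N : ℕ}
    (hk : k < N) :
    iteratedDeriv k (fun z => ∑ i ∈ Finset.range N, (z - z₀) ^ i • c i) z₀
      = k.factorial • c k := by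
  rw [iteratedDeriv_eq_factorial_smul_of_hasSum (c := fun i => if i < N then c i else 0),
    if_pos hk]
  refine Eventually.of_forall fun z => ?_
  have e : ∑ i ∈ Finset.range N, (z - z₀) ^ i • c i
      = ∑ i ∈ Finset.range N, (z - z₀) ^ i • (if i < N then c i else 0) :=
    Finset.sum_congr rfl fun i hi => by rw [if_pos (Finset.mem_range.1 hi)]
  rw [e]
  exact hasSum_sum_of_ne_finset_zero fun i hi => by
    rw [if_neg (by simpa using hi), smul_zero]

section FaaDiBruno

variable {𝕜 : Type*} [RCLike 𝕜] [NormedAlgebra 𝕜 ℂ] [IsScalarTower ℝ 𝕜 ℂ]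

/-- Faà di Bruno's formula over ordered set partitions. It shows that the `n`-th derivative of
`f ∘ g` depends only on the derivatives of `f` and `g` of order at most `n`. -/
theorem iteratedDeriv_comp_eq_sum_prod_smul {f : 𝕜 → ℂ} {g : ℝ → 𝕜} {t : ℝ} {n : ℕ}
    (hf : ContDiffAt 𝕜 n f (g t)) (hg : ContDiffAt ℝ n g t) :
    iteratedDeriv n (fun s => f (g s)) t = ∑ c : OrderedFinpartition n,
      (∏ j, iteratedDeriv (c.partSize j) g t) • iteratedDeriv c.length f (g t) := by
  have h := iteratedDeriv_vcomp_eq_sum_orderedFinpartition (𝕜 := ℝ) (n := n) (i := n)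
    (hf.restrict_scalars ℝ) hg le_rfl
  refine h.trans (Finset.sum_congr rfl fun c _ => ?_)
  have hc : ContDiffAt 𝕜 c.length f (g t) := hf.of_le (by exact_mod_cast c.length_le)
  rw [← hc.restrictScalars_iteratedFDeriv (𝕜 := ℝ)]
  simp [iteratedFDeriv_apply_eq_iteratedDeriv_mul_prod]

/-- The multinomial theorem for the `n`-th coefficient of a power of a polynomial of degree at most
`n` without constant term. -/
theorem coeff_sum_C_mul_X_pow_pow (n k : ℕ) (e : Fin n → ℂ) :
    ((∑ i : Fin n, Polynomial.C (e i) * Polynomial.X ^ ((i : ℕ) + 1)) ^ k).coeff n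
      = ∑ P ∈ faaDiBrunoTuples n k, (Nat.multinomial Finset.univ P : ℂ) * ∏ i, e i ^ P i := by
  rw [Finset.sum_pow_eq_sum_piAntidiag, Polynomial.finsetSum_coeff, faaDiBrunoTuples,
    Finset.sum_filter]
  refine Finset.sum_congr rfl fun P _ => ?_
  have h : (Nat.multinomial Finset.univ P : Polynomial ℂ)
      * ∏ i, (Polynomial.C (e i) * Polynomial.X ^ ((i : ℕ) + 1)) ^ P i
      = Polynomial.C ((Nat.multinomial Finset.univ P : ℂ) * ∏ i, e i ^ P i)
        * Polynomial.X ^ (∑ i : Fin n, ((i : ℕ) + 1) * P i) := by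
    simp only [mul_pow, Finset.prod_mul_distrib, ← pow_mul, Finset.prod_pow_eq_pow_sum, map_mul,
      map_prod, map_pow, map_natCast, mul_assoc]
  rw [h, Polynomial.coeff_C_mul_X_pow]
  simp only [eq_comm]

/-- The Faà di Bruno sum is the `n`-th derivative of `f ∘ g`. Both depend only on the derivatives
of `f` and `g` up to order `n`, so `f` and `g` may be replaced by their Taylor polynomials; the
coefficients of the composition of two polynomials come from the multinomial theorem. -/
theorem faaDiBrunoSum_eq_iteratedDeriv {f : 𝕜 → ℂ} {g : ℝ → 𝕜} {t : ℝ} {n : ℕ} (hn : n ≠ 0)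
    (hf : ContDiffAt 𝕜 n f (g t)) (hg : ContDiffAt ℝ n g t) :
    faaDiBrunoSum f g n t = iteratedDeriv n (fun s => f (g s)) t := by
  set c : ℕ → ℂ := fun k => iteratedDeriv k f (g t) / (k.factorial : ℂ) with hc
  set d : ℕ → 𝕜 := fun i => iteratedDeriv i g t / (i.factorial : 𝕜) with hd
  set F : 𝕜 → ℂ := fun y => ∑ k ∈ Finset.range (n + 1), (y - g t) ^ k • c k with hF
  set G : ℝ → 𝕜 := fun s => ∑ i ∈ Finset.range (n + 1), (s - t) ^ i • d i with hG
  have hGF : ∀ k ≤ n, iteratedDeriv k F (g t) = iteratedDeriv k f (g t) := fun k hk => by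
    rw [hF, iteratedDeriv_sum_range_pow_smul c _ (Nat.lt_succ_of_le hk), nsmul_eq_mul, hc]
    field_simp [Nat.factorial_ne_zero]
  have hGg : ∀ k ≤ n, iteratedDeriv k G t = iteratedDeriv k g t := fun k hk => by
    rw [hG, iteratedDeriv_sum_range_pow_smul d _ (Nat.lt_succ_of_le hk), nsmul_eq_mul, hd]
    field_simp [Nat.factorial_ne_zero]
  have hGt : G t = g t := by simpa using hGg 0 (Nat.zero_le _)
  have hFc : ContDiff 𝕜 n F := by fun_prop
  have hGc : ContDiff ℝ n G := by fun_prop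
  -- replace `f` and `g` by their Taylor polynomials
  have hswap : iteratedDeriv n (fun s => f (g s)) t = iteratedDeriv n (fun s => F (G s)) t := by
    rw [iteratedDeriv_comp_eq_sum_prod_smul hf hg,
      iteratedDeriv_comp_eq_sum_prod_smul hFc.contDiffAt hGc.contDiffAt]
    refine Finset.sum_congr rfl fun p _ => ?_
    rw [hGt, hGF _ p.length_le]
    congr 1
    exact Finset.prod_congr rfl fun j _ => (hGg _ (p.partSize_le j)).symm
  set e : Fin n → ℂ := fun i => algebraMap 𝕜 ℂ (d (i + 1)) with he
  set Q : Polynomial ℂ := ∑ k ∈ Finset.range (n + 1), Polynomial.C (c k) *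
    (∑ i : Fin n, Polynomial.C (e i) * Polynomial.X ^ ((i : ℕ) + 1)) ^ k with hQ
  have hFG : ∀ s, F (G s) = Q.eval ((s - t : ℝ) : ℂ) := by
    intro s
    have h1 : algebraMap 𝕜 ℂ (G s - g t)
        = ∑ i : Fin n, e i * ((s - t : ℝ) : ℂ) ^ ((i : ℕ) + 1) := by
      rw [hG]
      simp only
      rw [Finset.sum_range_succ', hd]
      simp only [pow_zero, one_smul, iteratedDeriv_zero, Nat.factorial_zero, Nat.cast_one, div_one,
        add_sub_cancel_right]
      rw [map_sum, Finset.sum_range]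
      refine Finset.sum_congr rfl fun i _ => ?_
      rw [Algebra.algebraMap_eq_smul_one, smul_assoc, ← Algebra.algebraMap_eq_smul_one,
        Complex.real_smul, mul_comm, Complex.ofReal_pow]
    simp only [hF, hQ, Polynomial.eval_finsetSum, Polynomial.eval_mul, Polynomial.eval_C,
      Polynomial.eval_pow, Polynomial.eval_X]
    refine Finset.sum_congr rfl fun k _ => ?_
    rw [← h1, Algebra.smul_def, map_pow, mul_comm]
  have hderiv : iteratedDeriv n (fun s => F (G s)) t = n.factorial • Q.coeff n := by
    have h1 : (fun s => F (G s))
        = fun s => ∑ k ∈ Finset.range (Q.natDegree + n + 1), (s - t) ^ k • Q.coeff k := by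
      ext s
      rw [hFG, Polynomial.eval_eq_sum_range' (n := Q.natDegree + n + 1) (by omega)]
      refine Finset.sum_congr rfl fun k _ => ?_
      rw [Complex.real_smul, mul_comm, Complex.ofReal_pow]
    rw [h1, iteratedDeriv_sum_range_pow_smul _ _ (by omega)]
  rw [hswap, hderiv, hQ, Polynomial.finsetSum_coeff]
  simp only [Polynomial.coeff_C_mul, coeff_sum_C_mul_X_pow_pow]
  -- the factors `i` in the Faà di Bruno sum multiply to `n!`
  have hfact : ∏ i : Fin n, ((((i : ℕ) + 1 : ℕ)) : ℂ) = n.factorial := by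
    rw [← Finset.prod_range_add_one_eq_factorial, Finset.prod_range]
    push_cast
    rfl
  -- the constant term of the outer polynomial does not contribute to the coefficient
  have hzero : c 0 * ∑ P ∈ faaDiBrunoTuples n 0,
      (Nat.multinomial Finset.univ P : ℂ) * ∏ i, e i ^ P i = 0 := by
    rw [← coeff_sum_C_mul_X_pow_pow, pow_zero, Polynomial.coeff_one, if_neg hn, mul_zero]
  have hrange : Finset.range (n + 1) = insert 0 (Finset.Icc 1 n) := by
    ext k
    simp only [Finset.mem_range, Finset.mem_insert, Finset.mem_Icc]
    omega
  rw [hrange, Finset.sum_insert (by simp), hzero, zero_add, nsmul_eq_mul, Finset.mul_sum,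
    faaDiBrunoSum]
  refine Finset.sum_congr rfl fun k _ => ?_
  rw [Finset.sum_smul, Finset.mul_sum, Finset.mul_sum]
  refine Finset.sum_congr rfl fun P hP => ?_
  have hPk : ∑ i, P i = k := by
    have := (Finset.mem_filter.1 hP).1
    rw [Finset.mem_piAntidiag] at this
    exact this.1
  have hmult : (k.factorial : ℂ)
      = (∏ i, ((P i).factorial : ℂ)) * (Nat.multinomial Finset.univ P : ℂ) := by
    rw [← hPk]
    exact_mod_cast (Nat.multinomial_spec Finset.univ P).symm
  have hPne : (∏ i, ((P i).factorial : ℂ)) ≠ 0 :=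
    Finset.prod_ne_zero_iff.2 fun i _ => by exact_mod_cast (P i).factorial_ne_zero
  have hkne : (k.factorial : ℂ) ≠ 0 := by exact_mod_cast k.factorial_ne_zero
  rw [Algebra.smul_def, map_prod]
  simp only [map_mul, map_div₀, map_pow, map_natCast]
  have hprod : ∏ i : Fin n, ((((i : ℕ) + 1 : ℕ)) : ℂ)
        / (((P i).factorial : ℂ) * ((((i : ℕ) + 1).factorial : ℕ) : ℂ) ^ P i)
          * algebraMap 𝕜 ℂ (iteratedDeriv ((i : ℕ) + 1) g t) ^ P i
      = n.factorial / (∏ i, ((P i).factorial : ℂ)) * ∏ i, e i ^ P i := by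
    rw [← hfact, ← Finset.prod_div_distrib, ← Finset.prod_mul_distrib]
    refine Finset.prod_congr rfl fun i _ => ?_
    simp only [he, hd, map_div₀, map_natCast, div_pow]
    have h1 : ((P i).factorial : ℂ) ≠ 0 := by exact_mod_cast (P i).factorial_ne_zero
    have h2 : ((((i : ℕ) + 1).factorial : ℕ) : ℂ) ≠ 0 := by
      exact_mod_cast ((i : ℕ) + 1).factorial_ne_zero
    field_simp
  rw [hprod, hc]
  simp only
  rw [hmult] at hkne ⊢
  have := right_ne_zero_of_mul hkne
  field_simp

end FaaDiBruno

/-! ### The expansion at the centre of a disc -/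

theorem choose_succ_right_eq_div {K : Type*} [Field K] [CharZero K] [BinomialRing K]
    (r : K) (k : ℕ) :
    Ring.choose r (k + 1) = Ring.choose r k * ((r - k) / (k + 1)) := by
  have h1 : ((k.factorial : ℕ) : K) ≠ 0 := by exact_mod_cast k.factorial_ne_zero
  have h2 : (k : K) + 1 ≠ 0 := by exact_mod_cast k.succ_ne_zero
  have e1 := Ring.descPochhammer_eq_factorial_smul_choose r k
  have e2 := Ring.descPochhammer_eq_factorial_smul_choose r (k + 1)
  rw [descPochhammer_succ_right, Polynomial.smeval_mul, e1, Nat.factorial_succ] at e2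
  simp only [Polynomial.smeval_sub, Polynomial.smeval_X, Polynomial.smeval_natCast, pow_one,
    pow_zero, nsmul_eq_mul, mul_one] at e2
  push_cast at e2
  field_simp
  refine mul_left_cancel₀ h1 ?_
  linear_combination -e2

/-- Binomial coefficients of `λ` with `Re λ > -1` decay fast enough for their quotients by `n + 1`
to be summable: from some index on, `ε |binom λ k| / (k + 1)` is at most the difference of
consecutive absolute values, and the differences telescope. -/
theorem summable_norm_choose_div {lam : ℂ} (hlam : -1 < lam.re) :
    Summable (fun k : ℕ => ‖Ring.choose lam k‖ / (k + 1)) := by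
  set ε := (lam.re + 1) / 2 with hε
  have hε0 : 0 < ε := by rw [hε]; linarith
  obtain ⟨N, hN⟩ := exists_nat_ge (max (lam.im ^ 2 / (2 * ε) + lam.re) (ε - 1))
  have hnorm : ∀ k : ℕ, N ≤ k → ‖lam - k‖ ≤ (k + 1) - ε := by
    intro k hk
    have hk' : (N : ℝ) ≤ k := by exact_mod_cast hk
    have h1 : lam.im ^ 2 / (2 * ε) ≤ k - lam.re := by
      linarith [le_max_left (lam.im ^ 2 / (2 * ε) + lam.re) (ε - 1)]
    have h2 : 0 ≤ (k : ℝ) + 1 - ε := by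
      linarith [le_max_right (lam.im ^ 2 / (2 * ε) + lam.re) (ε - 1)]
    rw [div_le_iff₀ (by positivity)] at h1
    refine abs_le_of_sq_le_sq' (a := ‖lam - k‖) ?_ h2 |>.2
    -- `(k - Re λ)² + (Im λ)² ≤ (k - Re λ + ε)²` as soon as `(Im λ)² ≤ 2 ε (k - Re λ)`
    rw [Complex.sq_norm, Complex.normSq_apply]
    simp only [Complex.sub_re, Complex.natCast_re, Complex.sub_im, Complex.natCast_im, sub_zero]
    have e : (k : ℝ) + 1 - ε = (k - lam.re) + ε := by rw [hε]; ring
    rw [e]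
    nlinarith
  have hstep : ∀ k : ℕ, N ≤ k → ε * (‖Ring.choose lam k‖ / (k + 1))
      ≤ ‖Ring.choose lam k‖ - ‖Ring.choose lam (k + 1)‖ := by
    intro k hk
    have hk1 : (0 : ℝ) < k + 1 := by positivity
    have e : ‖Ring.choose lam (k + 1)‖ = ‖Ring.choose lam k‖ * (‖lam - k‖ / (k + 1)) := by
      rw [choose_succ_right_eq_div, norm_mul, norm_div]
      congr 2
      exact_mod_cast Complex.norm_natCast (k + 1)
    have h1 : ‖lam - k‖ / (k + 1) ≤ 1 - ε / (k + 1) := by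
      rw [div_le_iff₀ hk1, sub_mul, div_mul_cancel₀ _ hk1.ne', one_mul]
      exact hnorm k hk
    rw [e]
    calc ε * (‖Ring.choose lam k‖ / (k + 1))
        = ‖Ring.choose lam k‖ - ‖Ring.choose lam k‖ * (1 - ε / (k + 1)) := by ring
      _ ≤ _ := by gcongr
  refine (summable_nat_add_iff N).1 ?_
  refine summable_of_sum_range_le (c := ‖Ring.choose lam N‖ / ε)
    (fun k => by positivity) fun n => ?_
  rw [le_div_iff₀ hε0]
  have : (∑ i ∈ Finset.range n, ‖Ring.choose lam (i + N)‖ / (((i + N : ℕ) : ℝ) + 1)) * ε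
      ≤ ‖Ring.choose lam N‖ - ‖Ring.choose lam (n + N)‖ := by
    induction n with
    | zero => simp
    | succ n ih =>
      rw [Finset.sum_range_succ, add_mul]
      have := hstep (n + N) (by omega)
      rw [show n + 1 + N = n + N + 1 by ring]
      linarith
  linarith [norm_nonneg (Ring.choose lam (n + N))]

theorem hasSum_one_sub_cpow (lam : ℂ) {w : ℂ} (hw : ‖w‖ < 1) :
    HasSum (fun j : ℕ => (-1) ^ j * Ring.choose lam j * w ^ j) ((1 - w) ^ lam) := by
  have h := (Complex.one_add_cpow_hasFPowerSeriesOnBall_zero (a := lam)).hasSum (y := -w)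
    (by simpa [Metric.mem_eball, edist_zero_right, ← ofReal_norm, ENNReal.ofReal_lt_one] using hw)
  rw [zero_add, ← sub_eq_add_neg] at h
  refine h.congr_fun fun j => ?_
  rw [binomialSeries_apply, List.ofFn_const, List.prod_replicate, neg_pow, smul_eq_mul]
  ring

/-- The coefficients of the expansion of `x ↦ (x - a) ^ λ η(x)` at `t` in powers of
`w = (t - x) / (t - a)`: the Cauchy product of the binomial series of `(1 - w) ^ λ` and the Taylor
series of `η`, times `(t - a) ^ λ`. -/
noncomputable def diskCoeff (lam : ℂ) (η : ℂ → ℂ) (a t : ℝ) (n : ℕ) : ℂ :=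
  ((t - a : ℝ) : ℂ) ^ lam * ∑ p ∈ Finset.HasAntidiagonal.antidiagonal n,
    ((-1) ^ p.1 * Ring.choose lam p.1) *
    (iteratedDeriv p.2 η t / p.2.factorial * (-((t - a : ℝ) : ℂ)) ^ p.2)

/-- Cauchy's estimate on a disc of radius `ρ`, for the Taylor coefficients scaled to radius `r`. -/
theorem norm_scaled_taylorCoeff_le {η : ℂ → ℂ} {z : ℂ} {r ρ M : ℝ} (hr : 0 ≤ r) (hρ : 0 < ρ)
    (hη : DifferentiableOn ℂ η (Metric.closedBall z ρ))
    (hM : ∀ y ∈ Metric.closedBall z ρ, ‖η y‖ ≤ M)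
    (l : ℕ) : ‖iteratedDeriv l η z / l.factorial * (-(r : ℂ)) ^ l‖ ≤ M * (r / ρ) ^ l := by
  have h := Complex.norm_iteratedDeriv_le_of_forall_mem_sphere_norm_le l hρ
    (hη.mono Metric.closure_ball_subset_closedBall).diffContOnCl
    (fun y hy => hM y (Metric.sphere_subset_closedBall hy))
  have hl : (0 : ℝ) < l.factorial := by exact_mod_cast l.factorial_pos
  rw [norm_mul, norm_div, norm_pow, norm_neg, Complex.norm_real, Real.norm_of_nonneg hr,
    Complex.norm_natCast]
  calc ‖iteratedDeriv l η z‖ / l.factorial * r ^ l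
      ≤ (l.factorial * M / ρ ^ l) / l.factorial * r ^ l := by gcongr
    _ = _ := by
      rw [div_pow]
      field_simp

/-- The coefficients divided by `n + 1` are absolutely summable, with an explicit bound. -/
theorem diskCoeff_summable_and_le {lam : ℂ} (hlam : -1 < lam.re) {η : ℂ → ℂ} {a t ρ q M : ℝ}
    (hat : a < t) (hρ : 0 < ρ) (hq1 : q < 1) (hrq : (t - a) / ρ ≤ q)
    (hη : DifferentiableOn ℂ η (Metric.closedBall (t : ℂ) ρ))
    (hM : ∀ y ∈ Metric.closedBall (t : ℂ) ρ, ‖η y‖ ≤ M) :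
    Summable (fun n : ℕ => ‖diskCoeff lam η a t n‖ / (n + 1)) ∧
    ∑' n : ℕ, ‖diskCoeff lam η a t n‖ / (n + 1)
      ≤ (t - a) ^ lam.re * ((∑' k : ℕ, ‖Ring.choose lam k‖ / (k + 1)) * (M * (1 - q)⁻¹)) := by
  have hr : 0 < t - a := by linarith
  have hq0 : 0 ≤ q := le_trans (by positivity) hrq
  have hM0 : 0 ≤ M := (norm_nonneg _).trans (hM t (Metric.mem_closedBall_self hρ.le))
  have hA := summable_norm_choose_div hlam
  have hG : Summable (fun l : ℕ => M * q ^ l) := (summable_geometric_of_lt_one hq0 hq1).mul_left M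
  have hA' : Summable (fun k : ℕ => ‖‖Ring.choose lam k‖ / ((k : ℝ) + 1)‖) := hA.norm
  have hG' : Summable (fun l : ℕ => ‖M * q ^ l‖) := hG.norm
  have hle : ∀ n : ℕ, ‖diskCoeff lam η a t n‖ / (n + 1) ≤ (t - a) ^ lam.re *
      ∑ p ∈ Finset.HasAntidiagonal.antidiagonal n,
        ‖Ring.choose lam p.1‖ / ((p.1 : ℝ) + 1) * (M * q ^ p.2) := by
    intro n
    rw [diskCoeff, norm_mul, Complex.norm_cpow_eq_rpow_re_of_pos hr, mul_div_assoc]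
    gcongr
    rw [div_le_iff₀ (by positivity)]
    refine (norm_sum_le _ _).trans ?_
    rw [Finset.sum_mul]
    refine Finset.sum_le_sum fun p hp => ?_
    have hp1 : (p.1 : ℝ) + 1 ≤ n + 1 := by
      have := Finset.HasAntidiagonal.mem_antidiagonal.1 hp
      have : p.1 ≤ n := by omega
      gcongr
    have h1 := (norm_scaled_taylorCoeff_le hr.le hρ hη hM p.2).trans
      (by gcongr : M * ((t - a) / ρ) ^ p.2 ≤ M * q ^ p.2)
    rw [norm_mul, norm_mul, norm_pow, norm_neg, norm_one, one_pow, one_mul]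
    calc ‖Ring.choose lam p.1‖ * ‖iteratedDeriv p.2 η t / p.2.factorial *
          (-((t - a : ℝ) : ℂ)) ^ p.2‖
        ≤ ‖Ring.choose lam p.1‖ * (M * q ^ p.2) := by gcongr
      _ = ‖Ring.choose lam p.1‖ / ((p.1 : ℝ) + 1) * (M * q ^ p.2) * ((p.1 : ℝ) + 1) := by
        field_simp
      _ ≤ _ := by gcongr
  have hS := (summable_norm_sum_mul_antidiagonal_of_summable_norm hA' hG').of_norm.mul_left
    ((t - a) ^ lam.re)
  have hsum := Summable.of_nonneg_of_le (fun n => by positivity) hle hS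
  refine ⟨hsum, (hsum.tsum_le_tsum hle hS).trans (le_of_eq ?_)⟩
  rw [tsum_mul_left, ← tsum_mul_tsum_eq_tsum_sum_antidiagonal_of_summable_norm hA' hG',
    tsum_mul_left (a := M), tsum_geometric_of_lt_one hq0 hq1]

/-- For discs contained in the domain of `η`, the coefficients divided by `n + 1` are absolutely
summable, uniformly for nearby centres. -/
theorem exists_eventually_diskCoeff_bound {lam : ℂ} (hlam : -1 < lam.re) {η : ℂ → ℂ} {R : Set ℂ}
    (hR : IsOpen R) (hη : DifferentiableOn ℂ η R) {a t₀ : ℝ} (hat : a < t₀)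
    (hball : Metric.closedBall (t₀ : ℂ) (t₀ - a) ⊆ R) :
    ∃ K : ℝ, ∀ᶠ t in 𝓝 t₀, Summable (fun n : ℕ => ‖diskCoeff lam η a t n‖ / (n + 1)) ∧
      ∑' n : ℕ, ‖diskCoeff lam η a t n‖ / (n + 1) ≤ K := by
  obtain ⟨δ, hδ, hsub⟩ := (isCompact_closedBall (t₀ : ℂ) (t₀ - a)).exists_cthickening_subset_open
    hR hball
  rw [cthickening_closedBall hδ.le (by linarith)] at hsub
  obtain ⟨M, hM⟩ := (isCompact_closedBall (t₀ : ℂ) (δ + (t₀ - a))).exists_bound_of_continuousOn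
    (hη.continuousOn.mono hsub)
  have hM0 : 0 ≤ M := (norm_nonneg _).trans (hM t₀ (Metric.mem_closedBall_self (by linarith)))
  set r₀ := t₀ - a with hr₀
  have hr₀0 : 0 < r₀ := by linarith
  -- for `|t - t₀| < δ / 4` the disc of radius `r₀ + 3 δ / 4` about `t` stays in the larger disc,
  -- and `t - a < r₀ + δ / 4` keeps the ratio of the Taylor series of `η` below `q`
  set q := (r₀ + δ / 4) / (r₀ + 3 * δ / 4) with hq
  have hq1 : q < 1 := by rw [hq, div_lt_one (by positivity)]; linarith
  set A := (∑' k : ℕ, ‖Ring.choose lam k‖ / ((k : ℝ) + 1)) * (M * (1 - q)⁻¹) with hA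
  have hA0 : 0 ≤ A := mul_nonneg (tsum_nonneg fun k => by positivity)
    (mul_nonneg hM0 (inv_nonneg.2 (by linarith)))
  refine ⟨(r₀ ^ lam.re + 1) * A, ?_⟩
  have hcont : ContinuousAt (fun t : ℝ => (t - a) ^ lam.re) t₀ :=
    ContinuousAt.rpow_const (by fun_prop) (Or.inl hr₀0.ne')
  have h1 : ∀ᶠ t in 𝓝 t₀, (t - a) ^ lam.re < r₀ ^ lam.re + 1 :=
    hcont.eventually_lt_const (by simp [hr₀])
  filter_upwards [h1, Metric.ball_mem_nhds t₀ (ε := δ / 4) (by positivity),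
    lt_mem_nhds hat] with t ht1 ht2 ht3
  rw [Metric.mem_ball, Real.dist_eq] at ht2
  have ht4 := abs_lt.1 ht2
  have hb : Metric.closedBall (t : ℂ) (r₀ + 3 * δ / 4) ⊆ Metric.closedBall (t₀ : ℂ) (δ + r₀) := by
    refine Metric.closedBall_subset_closedBall' ?_
    rw [Complex.dist_eq, ← Complex.ofReal_sub, Complex.norm_real, Real.norm_eq_abs]
    linarith
  obtain ⟨s1, s2⟩ := diskCoeff_summable_and_le hlam (q := q) (ρ := r₀ + 3 * δ / 4) (M := M) ht3
    (by positivity) hq1 (by rw [hq]; gcongr; linarith) (hη.mono (hb.trans hsub))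
    (fun y hy => hM y (hb hy))
  refine ⟨s1, s2.trans ?_⟩
  gcongr

/-- The expansion of `x ↦ (x - a) ^ λ η(x)` at `t`, valid on `|x - t| < t - a`. -/
theorem hasSum_diskCoeff (lam : ℂ) {η : ℂ → ℂ} {a t : ℝ} (hat : a < t)
    (hη : DifferentiableOn ℂ η (Metric.ball (t : ℂ) (t - a))) {w : ℝ} (hw : |w| < 1) :
    HasSum (fun n : ℕ => (w : ℂ) ^ n * diskCoeff lam η a t n)
      ((((t - a) * (1 - w) : ℝ) : ℂ) ^ lam * η ((t - (t - a) * w : ℝ))) := by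
  have hr : 0 < t - a := by linarith
  have hw' : ‖(w : ℂ)‖ < 1 := by rwa [Complex.norm_real, Real.norm_eq_abs]
  have h1 := hasSum_one_sub_cpow lam hw'
  have hmem : ((t - (t - a) * w : ℝ) : ℂ) ∈ Metric.ball (t : ℂ) (t - a) := by
    rw [Metric.mem_ball, Complex.dist_eq, ← Complex.ofReal_sub, Complex.norm_real,
      Real.norm_eq_abs, show t - (t - a) * w - t = -((t - a) * w) by ring, abs_neg, abs_mul,
      abs_of_pos hr]
    nlinarith
  have h2 := Complex.hasSum_taylorSeries_on_ball hη hmem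
  have h3 := (tsum_mul_tsum_eq_tsum_sum_antidiagonal_of_summable_norm h1.summable.norm
    h2.summable.norm)
  have h4 := (summable_norm_sum_mul_antidiagonal_of_summable_norm h1.summable.norm
    h2.summable.norm).of_norm.hasSum
  rw [← h3, h1.tsum_eq, h2.tsum_eq] at h4
  have h5 := h4.mul_left (((t - a : ℝ) : ℂ) ^ lam)
  have e0 : (((t - a) * (1 - w) : ℝ) : ℂ) ^ lam
      = ((t - a : ℝ) : ℂ) ^ lam * (1 - (w : ℂ)) ^ lam := by
    rw [Complex.ofReal_mul, Complex.mul_cpow_ofReal_nonneg hr.le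
      (by linarith [(abs_lt.1 hw).2]), Complex.ofReal_sub 1, Complex.ofReal_one]
  rw [← mul_assoc, ← e0] at h5
  refine h5.congr_fun fun n => ?_
  rw [diskCoeff, mul_left_comm, Finset.mul_sum]
  congr 1
  refine Finset.sum_congr rfl fun p hp => ?_
  rw [← Finset.HasAntidiagonal.mem_antidiagonal.1 hp, pow_add, smul_eq_mul, smul_eq_mul]
  have e : ((t - (t - a) * w : ℝ) : ℂ) - t = -((t - a : ℝ) : ℂ) * w := by push_cast; ring
  rw [e, mul_pow]
  ring

/-- The coefficients are the scaled derivatives of the expanded function. -/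
theorem iteratedDeriv_eq_diskCoeff (lam : ℂ) {η : ℂ → ℂ} {a t : ℝ} (hat : a < t)
    (hη : DifferentiableOn ℂ η (Metric.ball (t : ℂ) (t - a))) {h : ℝ → ℂ}
    (hh : ∀ᶠ s in 𝓝 t, h s = ((s - a : ℝ) : ℂ) ^ lam * η s) (n : ℕ) :
    iteratedDeriv n h t
      = n.factorial * (((-(t - a)⁻¹) ^ n : ℝ) * diskCoeff lam η a t n) := by
  have hr : 0 < t - a := by linarith
  rw [← nsmul_eq_mul]
  refine iteratedDeriv_eq_factorial_smul_of_hasSum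
    (c := fun n => (((-(t - a)⁻¹) ^ n : ℝ) : ℂ) * diskCoeff lam η a t n) ?_ n
  filter_upwards [hh, Metric.ball_mem_nhds t hr] with s hs hs'
  rw [Metric.mem_ball, Real.dist_eq] at hs'
  have hw : |(t - s) / (t - a)| < 1 := by
    rw [abs_div, abs_of_pos hr, div_lt_one hr, abs_sub_comm]
    exact hs'
  have := hasSum_diskCoeff lam hat hη hw
  rw [mul_sub, mul_one, mul_div_cancel₀ _ hr.ne'] at this
  rw [show t - a - (t - s) = s - a by ring, show t - (t - s) = s by ring] at this
  rw [hs]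
  refine this.congr_fun fun n => ?_
  rw [Complex.real_smul, ← mul_assoc, ← Complex.ofReal_mul, ← mul_pow, ← Complex.ofReal_pow]
  congr 3
  field_simp
  ring

/-! ### The double series for the convolution -/

/-- The real factor of the `(m, n)` term of the chain rule series: `r = t - a`, and the expansion
coefficient of order `n` of the composed function is split off. -/
noncomputable def chainWeight (α c r : ℝ) (m n : ℕ) : ℝ :=
  c ^ m * r ^ (m * α) / Real.Gamma (m * α + 1) * (m * α / (n + m * α))

/-- `binom(-β, n) = (-1) ^ n Γ(β + n) / (n! Γ(β))` for `n ≥ 1`, multiplied out so that it also holds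
at `β = 0`. -/
theorem choose_neg_mul_Gamma {β : ℝ} (hβ : 0 ≤ β) (n : ℕ) :
    Ring.choose (-β) (n + 1) * ((n + 1).factorial * (-1) ^ (n + 1)) * Real.Gamma (β + 1)
      = β * Real.Gamma (n + 1 + β) := by
  induction n with
  | zero => simp [add_comm]
  | succ n ih =>
    have h : Real.Gamma (((n + 1 : ℕ) : ℝ) + 1 + β) = (n + 1 + β) * Real.Gamma (n + 1 + β) := by
      rw [← Real.Gamma_add_one (by positivity)]
      push_cast
      ring_nf
    rw [h, choose_succ_right_eq_div, Nat.factorial_succ (n + 1), pow_succ (-1 : ℝ) (n + 1)]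
    have h2 : ((n + 1 : ℕ) : ℝ) + 1 ≠ 0 := by positivity
    push_cast at h2 ⊢
    field_simp
    linear_combination (n + 1 + β) * ih

/-- The bound separates the variables: it is summable in `m`, and in `n` the factor `1 / (n + 1)`
is what the expansion coefficients need. -/
theorem abs_chainWeight_le {α c r : ℝ} (hα0 : 0 < α) (hα1 : α < 1) (hr : 0 ≤ r) (m n : ℕ) :
    |chainWeight α c r m n|
      ≤ (|c| * r ^ α) ^ m * (m / Real.Gamma (m * α + 1)) * (1 / (n + 1)) := by
  have hΓ : 0 < Real.Gamma (m * α + 1) := Real.Gamma_pos_of_pos (by positivity)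
  have h1 : r ^ (m * α) = (r ^ α) ^ m := by
    rw [mul_comm, Real.rpow_mul hr, Real.rpow_natCast]
  have h2 : (m : ℝ) * α / (n + m * α) ≤ m * (1 / (n + 1)) := by
    rcases Nat.eq_zero_or_pos m with rfl | hm
    · simp
    · have hm1 : (1 : ℝ) ≤ m := by exact_mod_cast hm
      have hn0 : (0 : ℝ) ≤ n := by positivity
      rw [mul_one_div, div_le_div_iff₀ (by positivity) (by positivity)]
      have : α * (n + 1) ≤ n + m * α := by nlinarith
      nlinarith
  have h3 : 0 ≤ (m : ℝ) * α / (n + m * α) := by positivity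
  have h4 : 0 ≤ r ^ α := Real.rpow_nonneg hr _
  rw [chainWeight, h1, abs_mul, abs_div, abs_mul, abs_pow, abs_of_nonneg h3, abs_of_pos hΓ,
    abs_of_nonneg (pow_nonneg h4 m), ← mul_pow]
  calc (|c| * r ^ α) ^ m / Real.Gamma (m * α + 1) * (m * α / (n + m * α))
      ≤ (|c| * r ^ α) ^ m / Real.Gamma (m * α + 1) * (m * (1 / (n + 1))) := by gcongr
    _ = _ := by ring

theorem summable_pow_mul_natCast_div_Gamma {α : ℝ} (hα0 : 0 < α) (hα1 : α < 1) (x : ℝ) :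
    Summable (fun m : ℕ => x ^ m * (m / Real.Gamma (m * α + 1))) := by
  refine (summable_nat_add_iff 1).1 ?_
  refine ((summable_pow_div_Gamma_succ_mul hα0 hα1 x).mul_left α⁻¹).congr fun m => ?_
  have hΓ : Real.Gamma ((m + 1) * α) ≠ 0 := (Real.Gamma_pos_of_pos (by positivity)).ne'
  push_cast
  rw [Real.Gamma_add_one (by positivity)]
  field_simp

/-- Integrating the product of the expansion of `F` at `t` and of the series of the kernel term by
term. -/
theorem hasSum_convolution_mlKernel {α : ℝ} (hα0 : 0 < α) (hα1 : α < 1) (c : ℝ) {a t : ℝ}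
    (hat : a < t) (lam : ℂ) {η : ℂ → ℂ}
    (hη : DifferentiableOn ℂ η (Metric.ball (t : ℂ) (t - a)))
    (hC : Summable (fun n : ℕ => ‖diskCoeff lam η a t n‖ / (n + 1))) {F : ℝ → ℂ}
    (hF : ∀ x ∈ Ioo a t, F x = ((x - a : ℝ) : ℂ) ^ lam * η x) :
    Summable (fun p : ℕ × ℕ => (chainWeight α c (t - a) p.1 p.2 : ℂ) * diskCoeff lam η a t p.2) ∧
    HasSum (fun p : ℕ × ℕ =>
        (chainWeight α c (t - a) (p.1 + 1) p.2 : ℂ) * diskCoeff lam η a t p.2)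
      (∫ x in a..t, F x * (mlKernel α c (t - x) : ℂ)) := by
  set r := t - a with hr
  have hr0 : 0 < r := by linarith
  have hsummable : ∀ c : ℝ, Summable
      (fun p : ℕ × ℕ => ‖(chainWeight α c r p.1 p.2 : ℂ) * diskCoeff lam η a t p.2‖) := by
    intro c
    have h := (summable_pow_mul_natCast_div_Gamma hα0 hα1 (|c| * r ^ α)).mul_of_nonneg hC
      (fun m => by
        have := Real.Gamma_pos_of_pos (show 0 < (m : ℝ) * α + 1 by positivity)
        positivity) (fun n => by positivity)
    refine Summable.of_nonneg_of_le (fun p => norm_nonneg _) (fun p => ?_) h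
    rw [norm_mul, Complex.norm_real, Real.norm_eq_abs]
    calc _ ≤ _ * ‖diskCoeff lam η a t p.2‖ :=
          mul_le_mul_of_nonneg_right (abs_chainWeight_le hα0 hα1 hr0.le _ _) (norm_nonneg _)
      _ = _ := by ring
  refine ⟨(hsummable c).of_norm, ?_⟩
  have hshift : Function.Injective (fun p : ℕ × ℕ => (p.1 + 1, p.2)) := fun p q h => by
    simpa [Prod.ext_iff] using h
  -- the terms of the product expansion in `u = t - x`, and their integrals
  set T : ℝ → ℕ × ℕ → ℝ → ℂ := fun c p u =>
    ((c ^ (p.1 + 1) / Real.Gamma ((p.1 + 1) * α) * (r⁻¹ ^ p.2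
      * u ^ ((p.2 : ℝ) + (p.1 + 1) * α - 1)) : ℝ) : ℂ) * diskCoeff lam η a t p.2 with hT
  have hexp : ∀ p : ℕ × ℕ, 0 < (p.2 : ℝ) + (p.1 + 1) * α := fun p => by positivity
  have hrpow : ∀ p : ℕ × ℕ, ∫ u in Ioo 0 r, u ^ ((p.2 : ℝ) + (p.1 + 1) * α - 1)
      = r ^ p.2 * r ^ (((p.1 : ℝ) + 1) * α) / (p.2 + (p.1 + 1) * α) := fun p => by
    have h0 := hexp p
    rw [← integral_Ioc_eq_integral_Ioo, ← intervalIntegral.integral_of_le hr0.le,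
      integral_rpow (Or.inl (by linarith)), sub_add_cancel, Real.zero_rpow h0.ne', sub_zero,
      Real.rpow_add hr0, Real.rpow_natCast]
  have hweight : ∀ (c : ℝ) (p : ℕ × ℕ), c ^ (p.1 + 1) / Real.Gamma ((p.1 + 1) * α) * (r⁻¹ ^ p.2
      * (r ^ p.2 * r ^ (((p.1 : ℝ) + 1) * α) / (p.2 + (p.1 + 1) * α)))
      = chainWeight α c r (p.1 + 1) p.2 := fun c p => by
    have h0 := hexp p
    have hΓ : Real.Gamma ((p.1 + 1) * α) ≠ 0 := (Real.Gamma_pos_of_pos (by positivity)).ne'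
    rw [chainWeight]
    push_cast
    rw [Real.Gamma_add_one (by positivity), inv_pow]
    field_simp
  have hint : ∀ (c : ℝ) (p : ℕ × ℕ), ∫ u in Ioo 0 r, T c p u
      = (chainWeight α c r (p.1 + 1) p.2 : ℂ) * diskCoeff lam η a t p.2 := fun c p => by
    rw [hT]
    simp only
    rw [integral_mul_const, integral_complex_ofReal, integral_const_mul, integral_const_mul, hrpow,
      hweight]
  have key := hasSum_integral_of_summable_integral_norm (μ := volume.restrict (Ioo 0 r))
    (F := T c) (fun p => ?_) ?_
  · simp only [hint] at key
    suffices hψ : ∫ x in a..t, F x * (mlKernel α c (t - x) : ℂ)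
        = ∫ u in Ioo 0 r, ∑' p : ℕ × ℕ, T c p u by rw [hψ]; exact key
    have e := intervalIntegral.integral_comp_sub_left
      (fun x => F x * (mlKernel α c (t - x) : ℂ)) t (a := 0) (b := r)
    rw [show t - r = a by rw [hr]; ring, sub_zero] at e
    rw [← e, intervalIntegral.integral_of_le hr0.le, integral_Ioc_eq_integral_Ioo]
    refine setIntegral_congr_fun measurableSet_Ioo fun u hu => ?_
    have hw : |u / r| < 1 := by
      rw [abs_div, abs_of_pos hr0, abs_of_pos hu.1, div_lt_one hr0]
      exact hu.2
    have h1 := hasSum_diskCoeff lam hat hη hw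
    rw [mul_sub, mul_one, ← hr, mul_div_cancel₀ _ hr0.ne'] at h1
    have h2 := hF (t - u) ⟨by linarith [hu.2], by linarith [hu.1]⟩
    rw [show t - u - a = r - u by rw [hr]; ring] at h2
    rw [← h2] at h1
    have h3 := Complex.hasSum_ofReal.2 (hasSum_mlKernel hα0 hα1 c hu.1)
    have h4 := tsum_mul_tsum_of_summable_norm h3.summable.norm h1.summable.norm
    rw [sub_sub_cancel, mul_comm, ← h3.tsum_eq, ← h1.tsum_eq, h4]
    refine tsum_congr fun p => ?_
    rw [hT]
    simp only
    rw [← mul_assoc, ← Complex.ofReal_pow, ← Complex.ofReal_mul, div_pow,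
      show (p.2 : ℝ) + (p.1 + 1) * α - 1 = p.2 + ((p.1 + 1) * α - 1) by ring,
      Real.rpow_add hu.1, Real.rpow_natCast, inv_pow]
    congr 2
    ring
  · have h0 := hexp p
    have h1 : IntegrableOn (fun u : ℝ => u ^ ((p.2 : ℝ) + (p.1 + 1) * α - 1)) (Ioo 0 r) :=
      ((intervalIntegrable_iff_integrableOn_Ioo_of_le hr0.le).1
        (intervalIntegral.intervalIntegrable_rpow' (by linarith)))
    exact (((h1.const_mul _).const_mul _).ofReal).mul_const _
  · refine ((hsummable |c|).comp_injective hshift).congr fun p => ?_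
    have hΓ : 0 < Real.Gamma ((p.1 + 1) * α) := Real.Gamma_pos_of_pos (by positivity)
    have hnorm : ∫ u in Ioo 0 r, ‖T c p u‖
        = ∫ u in Ioo 0 r, (|c| ^ (p.1 + 1) / Real.Gamma ((p.1 + 1) * α) * (r⁻¹ ^ p.2
      * u ^ ((p.2 : ℝ) + (p.1 + 1) * α - 1))) * ‖diskCoeff lam η a t p.2‖ := by
      refine setIntegral_congr_fun measurableSet_Ioo fun u hu => ?_
      have hu0 : 0 < u ^ ((p.2 : ℝ) + (p.1 + 1) * α - 1) := Real.rpow_pos_of_pos hu.1 _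
      simp only [hT, norm_mul, Complex.norm_real, norm_div, norm_pow, norm_inv, Real.norm_eq_abs,
        abs_of_pos hΓ, abs_of_pos hr0, abs_of_pos hu0]
    rw [hnorm, integral_mul_const, integral_const_mul, integral_const_mul, hrpow, hweight]
    simp only [Function.comp, norm_mul, Complex.norm_real]
    congr 1
    refine Real.norm_of_nonneg ?_
    have := Real.Gamma_pos_of_pos (show 0 < ((p.1 + 1 : ℕ) : ℝ) * α + 1 by positivity)
    rw [chainWeight]
    positivity

/-! ### The derivative of the ABR integral and the terms of the series -/

theorem exists_Icc_ofReal_mem_of_closedBall {R : Set ℂ} (hR : IsOpen R) {a t : ℝ} (hat : a ≤ t)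
    (hball : Metric.closedBall (t : ℂ) (t - a) ⊆ R) : ∃ t₂ > t, ∀ x ∈ Icc a t₂, (x : ℂ) ∈ R := by
  refine exists_Icc_ofReal_mem hR hat fun x hx => hball ?_
  rw [Metric.mem_closedBall, Complex.dist_eq, ← Complex.ofReal_sub, Complex.norm_real,
    Real.norm_eq_abs, abs_le]
  constructor <;> linarith [hx.1, hx.2]

/-- The derivative of the ABR integral at a point where `F` is continuous is `F` plus the
convolution of `F` with the kernel. -/
theorem hasDerivAt_abrIntegral {α : ℝ} (hα0 : 0 < α) (hα1 : α < 1) {a b t : ℝ}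
    (ht : t ∈ Ioo a b) {lam : ℂ} (hlam : -1 < lam.re) {η : ℂ → ℂ} {R : Set ℂ} (hR : IsOpen R)
    (hη : ContinuousOn η R) (hball : Metric.closedBall (t : ℂ) (t - a) ⊆ R) {F : ℝ → ℂ}
    (hFint : IntegrableOn F (Ioo a b)) (hFt : ContinuousAt F t)
    (hform : ∀ s ∈ Ioo a b, (s : ℂ) ∈ R → F s = ((s - a : ℝ) : ℂ) ^ lam * η s) :
    HasDerivAt (abrIntegral α a F)
      (F t + ∫ x in a..t, F x * (mlKernel α (-α / (1 - α)) (t - x) : ℂ)) t := by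
  obtain ⟨t₂, ht₂, hseg⟩ := exists_Icc_ofReal_mem_of_closedBall hR ht.1.le hball
  obtain ⟨t₃, ht₃, ht₃'⟩ := exists_between (lt_min ht₂ ht.2)
  have h32 := ht₃'.trans_le (min_le_left _ _)
  have h3b := ht₃'.trans_le (min_le_right _ _)
  have hIoc : ∀ s ≤ t₃, IntegrableOn F (Ioc a s) := fun s hs =>
    hFint.mono_set fun x hx => ⟨hx.1, by linarith [hx.2]⟩
  set ψ : ℝ → ℂ := fun τ => ∫ x in a..τ, F x * (mlKernel α (-α / (1 - α)) (τ - x) : ℂ) with hψ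
  have hint : ∀ s, a ≤ s → s ≤ t₃ → IntervalIntegrable (fun τ => F τ + ψ τ) volume a s :=
    fun s h1 h2 => ((intervalIntegrable_iff_integrableOn_Ioc_of_le h1).2 (hIoc s h2)).add
      (abrIntegral_eq_integral hα0 hα1 h1 (hIoc s h2)).1
  have hcont : ContinuousAt ψ t := by
    refine continuousAt_convolution_mlKernel hα0 hα1 _ ht.1 hlam hR hη
      (fun x hx => hseg x ⟨hx.1, by linarith [hx.2]⟩) ?_
    filter_upwards [gt_mem_nhds ht₃] with s hs x hx
    exact hform x ⟨hx.1, by linarith [hx.2]⟩ (hseg x ⟨hx.1.le, by linarith [hx.2]⟩)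
  -- integrability on `(a, t₃]` supplies the measurability near `t`
  have hmeas : StronglyMeasurableAtFilter (fun τ => F τ + ψ τ) (𝓝 t) :=
    ⟨Ioc a t₃, Ioc_mem_nhds ht.1 ht₃,
      ((intervalIntegrable_iff_integrableOn_Ioc_of_le (by linarith [ht.1])).1
        (hint t₃ (by linarith [ht.1]) le_rfl)).aestronglyMeasurable⟩
  refine (intervalIntegral.integral_hasDerivAt_right (hint t ht.1.le ht₃.le) hmeas
    (hFt.add hcont)).congr_of_eventuallyEq ?_
  filter_upwards [lt_mem_nhds ht.1, gt_mem_nhds ht₃] with s h1 h2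
  exact (abrIntegral_eq_integral hα0 hα1 h1.le (hIoc s h2.le)).2

/-- A term of the chain rule series is a real weight times an expansion coefficient of `f ∘ g`. -/
theorem abrChainTerm_eq {𝕜 : Type*} [RCLike 𝕜] [NormedAlgebra 𝕜 ℂ] [IsScalarTower ℝ 𝕜 ℂ]
    {α : ℝ} (hα0 : 0 < α) {a t : ℝ} (hat : a < t) {f : 𝕜 → ℂ} {g : ℝ → 𝕜}
    (hf : ContDiffAt 𝕜 ∞ f (g t)) (hg : ContDiffAt ℝ ∞ g t) (lam : ℂ) {η : ℂ → ℂ}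
    (hη : DifferentiableOn ℂ η (Metric.ball (t : ℂ) (t - a)))
    (hh : ∀ᶠ s in 𝓝 t, f (g s) = ((s - a : ℝ) : ℂ) ^ lam * η s) (m n : ℕ) :
    abrChainTerm α a f g m (n + 1) t
      = (chainWeight α (-α / (1 - α)) (t - a) m (n + 1) : ℂ) * diskCoeff lam η a t (n + 1) := by
  have hr : 0 < t - a := by linarith
  rw [abrChainTerm, faaDiBrunoSum_eq_iteratedDeriv n.succ_ne_zero
    (hf.of_le (by exact_mod_cast le_top)) (hg.of_le (by exact_mod_cast le_top)),
    iteratedDeriv_eq_diskCoeff lam hat hη hh, ← mul_assoc, ← mul_assoc]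
  congr 1
  rw [← Complex.ofReal_natCast, ← Complex.ofReal_mul, ← Complex.ofReal_mul]
  congr 1
  have h1 := choose_neg_mul_Gamma (β := m * α) (by positivity) n
  have hΓ1 : Real.Gamma (m * α + 1) ≠ 0 := (Real.Gamma_pos_of_pos (by positivity)).ne'
  have hΓ2 : Real.Gamma (n + 1 + m * α) ≠ 0 := (Real.Gamma_pos_of_pos (by positivity)).ne'
  have h2 : Real.Gamma (((n + 1 : ℕ) : ℝ) + m * α + 1)
      = (n + 1 + m * α) * Real.Gamma (n + 1 + m * α) := by
    rw [Real.Gamma_add_one (by positivity)]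
    push_cast
    rfl
  have h3 : (t - a) ^ (((n + 1 : ℕ) : ℝ) + m * α) = (t - a) ^ (n + 1) * (t - a) ^ (m * α) := by
    rw [Real.rpow_add hr, Real.rpow_natCast]
  have h4 : (n : ℝ) + 1 + m * α ≠ 0 := by positivity
  have h5 : (-(t - a)⁻¹) ^ (n + 1) * (t - a) ^ (n + 1) = (-1) ^ (n + 1) := by
    rw [← mul_pow, neg_mul, inv_mul_cancel₀ hr.ne']
  rw [h2, h3, chainWeight, neg_mul]
  rw [← h5] at h1
  push_cast
  generalize (-(t - a)⁻¹) ^ (n + 1) = y at h1 ⊢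
  generalize (t - a) ^ (n + 1) = x at h1 ⊢
  generalize Ring.choose (-(m * α)) (n + 1) = z at h1 ⊢
  generalize Real.Gamma (m * α + 1) = G at h1 hΓ1 ⊢
  generalize Real.Gamma (n + 1 + m * α) = G' at h1 hΓ2 ⊢
  generalize (t - a) ^ (m * α) = w
  generalize (-α / (1 - α)) ^ m = v
  generalize (m : ℝ) * α = β at h1 h4 ⊢
  field_simp
  linear_combination v * w * h1

/-! ### The chain rule -/

/-- The terms of order `n = 0` in the expansion of the convolution add up to the term of the chain
rule that contains the Mittag-Leffler function. -/
theorem hasSum_chainWeight_succ_zero {α : ℝ} (hα0 : 0 < α) (hα1 : α < 1) (c : ℝ) {r : ℝ}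
    (hr : 0 ≤ r) :
    HasSum (fun m : ℕ => chainWeight α c r (m + 1) 0) (mittagLeffler α (c * r ^ α) - 1) := by
  have h := (summable_pow_div_Gamma hα0 hα1 one_pos (c * r ^ α)).hasSum
  rw [← hasSum_nat_add_iff' 1] at h
  rw [Finset.sum_range_one] at h
  simp only [pow_zero, Nat.cast_zero, mul_zero, zero_add, Real.Gamma_one, div_one] at h
  refine h.congr_fun fun m => ?_
  have h0 : ((m + 1 : ℕ) : ℝ) * α ≠ 0 := by positivity
  rw [chainWeight, Nat.cast_zero, zero_add, div_self h0, mul_one, mul_pow, mul_comm _ α,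
    Real.rpow_mul hr, Real.rpow_natCast]

/-- Chain rule for ABR derivatives. The field `𝕜` is `ℝ` or `ℂ`: the inner function `g` may be
real or complex valued. The points `t` at which the formula is asserted are those `t ∈ (a, b)` for
which the closed disc with centre `t` and radius `t - a` lies in the domain of analyticity `R`,
and for which all derivatives of `f` at `g t` make sense. -/
theorem mainTheorem8 {𝕜 : Type*} [RCLike 𝕜] [NormedAlgebra 𝕜 ℂ] [IsScalarTower ℝ 𝕜 ℂ]
    (B : ℝ → ℝ) (hB0 : B 0 = 1) (hB1 : B 1 = 1) (hBpos : ∀ β ∈ Icc (0 : ℝ) 1, 0 < B β)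
    (α : ℝ) (hα0 : 0 < α) (hα1 : α < 1) (a b : ℝ) (hab : a < b)
    (f : 𝕜 → ℂ) (g : ℝ → 𝕜) (hg : ContDiffOn ℝ ∞ g (Ioo a b))
    (hfg : MeasureTheory.IntegrableOn (fun s => f (g s)) (Ioo a b))
    (R : Set ℂ) (hR : IsOpen R) (haR : (a : ℂ) ∈ R)
    (η : ℂ → ℂ) (hη : AnalyticOnNhd ℂ η R) (lam : ℂ) (hlam : -1 < lam.re)
    (hform : ∀ s ∈ Ioo a b, (s : ℂ) ∈ R → f (g s) = ((s - a : ℝ) : ℂ) ^ lam * η s)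
    (S : Set ℝ)
    (hS : S = {t | t ∈ Ioo a b ∧ Metric.closedBall (t : ℂ) (t - a) ⊆ R ∧
      ContDiffAt 𝕜 ∞ f (g t)}) :
    (∀ t ∈ S,
      DifferentiableAt ℝ (abrIntegral α a (fun s => f (g s))) t ∧
      Summable (fun p : ℕ × ℕ => abrChainTerm α a f g p.1 (p.2 + 1) t) ∧
      abrDeriv B α a (fun s => f (g s)) t
        = ((B α / (1 - α) : ℝ) : ℂ) *
          ((mittagLeffler α (-α / (1 - α) * (t - a) ^ α) : ℂ) * f (g t)
            + ∑' m : ℕ, ∑' n : ℕ, abrChainTerm α a f g m (n + 1) t)) ∧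
    HasSumLocallyUniformlyOn
      (fun (m : ℕ) (t : ℝ) => ∑' n : ℕ, abrChainTerm α a f g m (n + 1) t)
      (fun t => ∑' m : ℕ, ∑' n : ℕ, abrChainTerm α a f g m (n + 1) t) S := by
  subst hS
  have hηd : DifferentiableOn ℂ η R := fun z hz => (hη z hz).differentiableAt.differentiableWithinAt
  set c := -α / (1 - α) with hc
  have hgt : ∀ t ∈ Ioo a b, ContDiffAt ℝ ∞ g t := fun t ht =>
    hg.contDiffAt (isOpen_Ioo.mem_nhds ht)
  have hdisk : ∀ t : ℝ, Metric.closedBall (t : ℂ) (t - a) ⊆ R →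
      DifferentiableOn ℂ η (Metric.ball (t : ℂ) (t - a)) := fun t ht =>
    hηd.mono (Metric.ball_subset_closedBall.trans ht)
  have hnear : ∀ t ∈ Ioo a b, Metric.closedBall (t : ℂ) (t - a) ⊆ R →
      ∀ᶠ s in 𝓝 t, f (g s) = ((s - a : ℝ) : ℂ) ^ lam * η s := fun t ht hb => by
    have h1 : ∀ᶠ s : ℝ in 𝓝 t, (s : ℂ) ∈ R :=
      Complex.continuous_ofReal.continuousAt.eventually_mem
        (hR.mem_nhds (hb (Metric.mem_closedBall_self (by linarith [ht.1]))))
    filter_upwards [h1, isOpen_Ioo.mem_nhds ht] with s hs1 hs2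
    exact hform s hs2 hs1
  have hterm : ∀ t ∈ Ioo a b, Metric.closedBall (t : ℂ) (t - a) ⊆ R → ContDiffAt 𝕜 ∞ f (g t) →
      ∀ m n, abrChainTerm α a f g m (n + 1) t
        = (chainWeight α c (t - a) m (n + 1) : ℂ) * diskCoeff lam η a t (n + 1) :=
    fun t ht hb hf m n => abrChainTerm_eq hα0 ht.1 hf (hgt t ht) lam (hdisk t hb)
      (hnear t ht hb) m n
  have hzero : ∀ r n, chainWeight α c r 0 n = 0 := fun r n => by simp [chainWeight]
  refine ⟨?_, ?_⟩
  · rintro t ⟨ht, hb, hf⟩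
    have hr : 0 < t - a := by linarith [ht.1]
    obtain ⟨K, hK⟩ := exists_eventually_diskCoeff_bound hlam hR hηd ht.1 hb
    obtain ⟨t₂, ht₂, hseg⟩ := exists_Icc_ofReal_mem_of_closedBall hR ht.1.le hb
    obtain ⟨hsum, hψ⟩ := hasSum_convolution_mlKernel hα0 hα1 c ht.1 lam (hdisk t hb)
      hK.self_of_nhds.1 (F := fun s => f (g s)) fun x hx =>
        hform x ⟨hx.1, hx.2.trans ht.2⟩ (hseg x ⟨hx.1.le, (hx.2.trans ht₂).le⟩)
    have hder := hasDerivAt_abrIntegral hα0 hα1 ht hlam hR hη.continuousOn hb hfg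
      (ContinuousAt.comp (f := g) (g := f) hf.continuousAt (hgt t ht).continuousAt) hform
    have hT : Summable (fun p : ℕ × ℕ => abrChainTerm α a f g p.1 (p.2 + 1) t) := by
      have hinj : Function.Injective (fun p : ℕ × ℕ => (p.1, p.2 + 1)) := fun p q h => by
        simpa [Prod.ext_iff] using h
      exact (hsum.comp_injective hinj).congr fun p => (hterm t ht hb hf _ _).symm
    refine ⟨hder.differentiableAt, hT, ?_⟩
    rw [abrDeriv, hder.deriv]
    congr 1
    -- summing the expansion of the convolution first over `n`, with `n = 0` split off
    have hrow : ∀ m, Summable fun n : ℕ =>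
        (chainWeight α c (t - a) (m + 1) n : ℂ) * diskCoeff lam η a t n :=
      fun m => hψ.summable.prod_factor m
    have h1 := hψ.summable.tsum_prod
    rw [hψ.tsum_eq] at h1
    have h2 : ∀ m, ∑' n : ℕ, (chainWeight α c (t - a) (m + 1) n : ℂ) * diskCoeff lam η a t n
        = (chainWeight α c (t - a) (m + 1) 0 : ℂ) * diskCoeff lam η a t 0
          + ∑' n : ℕ, abrChainTerm α a f g (m + 1) (n + 1) t := fun m => by
      rw [(hrow m).tsum_eq_zero_add]
      simp only [hterm t ht hb hf]
    have h3 : diskCoeff lam η a t 0 = f (g t) := by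
      have := iteratedDeriv_eq_diskCoeff lam ht.1 (hdisk t hb) (hnear t ht hb) 0
      simpa using this.symm
    have h4 := (Complex.hasSum_ofReal.2 (hasSum_chainWeight_succ_zero hα0 hα1 c hr.le)).mul_right
      (f (g t))
    have h5 : Summable fun m : ℕ => ∑' n : ℕ, abrChainTerm α a f g m (n + 1) t := hT.prod
    have h6 := (summable_nat_add_iff 1).2 h5
    have h7 : ∑' n : ℕ, abrChainTerm α a f g 0 (n + 1) t = 0 := by
      simp [hterm t ht hb hf, hzero]
    rw [h1]
    simp only [h2, h3]
    rw [h4.summable.tsum_add h6, h4.tsum_eq, h5.tsum_eq_zero_add, h7]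
    push_cast
    ring
  · refine hasSumLocallyUniformlyOn_of_of_forall_exists_nhds ?_
    rintro t₀ ⟨ht₀, hb₀, hf₀⟩
    obtain ⟨K, hK⟩ := exists_eventually_diskCoeff_bound hlam hR hηd ht₀.1 hb₀
    refine ⟨_, inter_mem (mem_nhdsWithin_of_mem_nhds hK) self_mem_nhdsWithin, ?_⟩
    refine HasSumUniformlyOn.of_norm_le_summable
      (u := fun m : ℕ => (|c| * (b - a) ^ α) ^ m * (m / Real.Gamma (m * α + 1)) * K)
      ((summable_pow_mul_natCast_div_Gamma hα0 hα1 _).mul_right K) ?_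
    rintro m t ⟨⟨hC, hCK⟩, ht, hb, hf⟩
    have hr : 0 < t - a := by linarith [ht.1]
    have hrb : t - a ≤ b - a := by linarith [ht.2]
    have hΓ : 0 < Real.Gamma (m * α + 1) := Real.Gamma_pos_of_pos (by positivity)
    set A := (|c| * (b - a) ^ α) ^ m * (m / Real.Gamma (m * α + 1)) with hA
    have hA0 : 0 ≤ A := by
      have : 0 ≤ (b - a) ^ α := Real.rpow_nonneg (by linarith) _
      positivity
    have hle : ∀ n, ‖abrChainTerm α a f g m (n + 1) t‖
        ≤ A * (‖diskCoeff lam η a t (n + 1)‖ / (((n + 1 : ℕ) : ℝ) + 1)) := fun n => by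
      rw [hterm t ht hb hf, norm_mul, Complex.norm_real, Real.norm_eq_abs]
      have h1 : |chainWeight α c (t - a) m (n + 1)| ≤ A * (1 / (((n + 1 : ℕ) : ℝ) + 1)) := by
        refine (abs_chainWeight_le hα0 hα1 hr.le m (n + 1)).trans ?_
        rw [hA]
        gcongr
      calc _ ≤ A * (1 / (((n + 1 : ℕ) : ℝ) + 1)) * ‖diskCoeff lam η a t (n + 1)‖ := by gcongr
        _ = _ := by ring
    have hC1 := (summable_nat_add_iff 1).2 hC
    refine (tsum_of_norm_bounded (hC1.hasSum.mul_left A) hle).trans ?_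
    refine mul_le_mul_of_nonneg_left (le_trans ?_ hCK) hA0
    rw [hC.tsum_eq_zero_add]
    exact le_add_of_nonneg_left (by positivity)
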